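/- Let $G$ be a compact (Hausdorff) group, equipped with its normalized Haar measure, and let $u\colon G\to\mathbb{C}$ be a continuous positive definite function with $u(e_G)=1$. Let $\lambda$ be the left regular representation of $G$ on $L^2(G)$, let $VN(G)\subseteq B(L^2(G))$ be the von Neumann algebra generated by $\{\lambda(t):t\in G\}$, and equip it with its Plancherel trace $\tau_G$, the normal semifinite faithful trace characterized by $\tau_G(\lambda(f)^*\lambda(f))=\|f\|_2^2$ for $f\in L^2(G)$, where $\lambda(f)=\int_G f(s)\lambda(s)\,ds$. Let $M_u\colon VN(G)\to VN(G)$ be the Fourier multiplier with symbol $u$, i.e. the unique normal linear map with $M_u(\lambda(t))=u(t)\lambda(t)$ for all $t\in G$; it exists since $u$ is positive definite. Equip $B(L^2(G))$ with its usual trace $\mathrm{tr}$, let $\varphi_u(s,t)=u(st^{-1})$ for $s,t\in G$, and let $T_{\varphi_u}\colon B(L^2(G))\to B(L^2(G))$ be the Schur multiplier with symbol $\varphi_u$, i.e. the unique normal linear map which, for every $F\in L^2(G\times G)$, sends the operator with integral kernel $F$, namely $g\mapsto\int_G F(\cdot,t)g(t)\,dt$, to the operator with integral kernel $\varphi_uF$.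 A linear operator $T\colon\mathcal{M}\to\mathcal{M}$ on a von Neumann algebra with a normal semifinite faithful trace $\tau_{\mathcal M}$ is said to admit an absolute dilation if there exist a von Neumann algebra $M$ with a normal semifinite faithful trace $\tau_M$, a normal unital trace preserving $*$-homomorphism $J\colon\mathcal{M}\to M$, and a trace preserving $*$-automorphism $U\colon M\to M$ such that $$T^k=\mathbb{E}_J\,U^k J\qquad\text{for all integers } k\ge 0,$$ where $\mathbb{E}_J\colon M\to\mathcal{M}$ is the conditional expectation associated with $J$, i.e. $\tau_{\mathcal M}(\mathbb{E}_J(y)x)=\tau_M(yJ(x))$ for all $y\in M$ and all positive $x\in\mathcal{M}$ with $\tau_{\mathcal M}(x)<\infty$. **Proposition.** If $T_{\varphi_u}\colon B(L^2(G))\to B(L^2(G))$ admits an absolute dilation, then $M_u\colon VN(G)\to VN(G)$ also admits an absolute dilation. -/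

import Mathlib

open MeasureTheory
open scoped ENNReal InnerProductSpace

noncomputable section

namespace AbsDilation

/-! ## von Neumann algebras, ultraweak topology, traces -/

section VonNeumann

variable {H : Type*} [NormedAddCommGroup H] [InnerProductSpace ℂ H] [CompleteSpace H]
variable {K : Type*} [NormedAddCommGroup K] [InnerProductSpace ℂ K] [CompleteSpace K]

/-- The type of elements of a von Neumann algebra `S ⊆ B(H)`, with its structure of a
unital `*`-algebra and the order of operators. -/
abbrev Elt (S : VonNeumannAlgebra H) : Type _ := S.toStarSubalgebra

/-- The von Neumann algebra `B(H)` of all bounded operators on `H`. -/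
def fullAlgebra (H : Type*) [NormedAddCommGroup H] [InnerProductSpace ℂ H] [CompleteSpace H] :
    VonNeumannAlgebra H where
  toStarSubalgebra := ⊤
  centralizer_centralizer' := by
    refine Set.eq_univ_of_forall fun x => ?_
    rw [Set.mem_centralizer_iff]
    intro m hm
    rw [Set.mem_centralizer_iff] at hm
    exact (hm x (Set.mem_univ x)).symm

/-- The ultraweak (that is, `w*`-) topology of a von Neumann algebra `S ⊆ B(H)`: the coarsest
topology making continuous all functionals `x ↦ ∑ₙ ⟪ηₙ, x ξₙ⟫` with
`∑ₙ ‖ξₙ‖² < ∞` and `∑ₙ ‖ηₙ‖² < ∞`. -/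
@[reducible]
def ultraweakTopology (S : VonNeumannAlgebra H) : TopologicalSpace (Elt S) :=
  ⨅ (ξ : ℕ → H) (η : ℕ → H) (_ : Summable fun n => ‖ξ n‖ ^ 2)
    (_ : Summable fun n => ‖η n‖ ^ 2),
    TopologicalSpace.induced
      (fun x : Elt S => ∑' n, ⟪η n, (x : H →L[ℂ] H) (ξ n)⟫_ℂ) inferInstance

/-- A map between von Neumann algebras is normal if it is `w*`-`w*`-continuous. -/
def IsNormalMap {S : VonNeumannAlgebra H} {R : VonNeumannAlgebra K} (f : Elt S → Elt R) : Prop :=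
  @Continuous _ _ (ultraweakTopology S) (ultraweakTopology R) f

/-- `τ` is a normal semifinite faithful trace on the von Neumann algebra `S`. A trace is a map
`S⁺ → [0,∞]`; it is given by a function on all of `S`, of which only the values on the
positive cone `S⁺` are ever used. -/
structure IsNSFTrace (S : VonNeumannAlgebra H) (τ : Elt S → ℝ≥0∞) : Prop where
  add : ∀ x y : Elt S, 0 ≤ x → 0 ≤ y → τ (x + y) = τ x + τ y
  smul : ∀ (c : ℝ) (x : Elt S), 0 ≤ c → 0 ≤ x → τ ((c : ℂ) • x) = ENNReal.ofReal c * τ x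
  tracial : ∀ x : Elt S, τ (star x * x) = τ (x * star x)
  /-- the trace preserves the suprema of bounded increasing families of positive elements -/
  normal : ∀ D : Set (Elt S), D.Nonempty → (∀ d ∈ D, 0 ≤ d) → DirectedOn (· ≤ ·) D →
    ∀ x : Elt S, IsLUB D x → τ x = ⨆ d ∈ D, τ d
  /-- every nonzero positive element dominates a nonzero positive element of finite trace -/
  semifinite : ∀ x : Elt S, 0 ≤ x → x ≠ 0 → ∃ y : Elt S, 0 ≤ y ∧ y ≤ x ∧ y ≠ 0 ∧ τ y < ∞
  faithful : ∀ x : Elt S, 0 ≤ x → τ x = 0 → x = 0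

/-- The linear extension of a trace: `HasTrace τ z c` means that `z` belongs to the linear span
of the positive elements of finite trace and that the value at `z` of the linear
extension of `τ` to this span is the complex number `c`. -/
def HasTrace {S : VonNeumannAlgebra H} (τ : Elt S → ℝ≥0∞) (z : Elt S) (c : ℂ) : Prop :=
  ∃ p₁ p₂ p₃ p₄ : Elt S,
    (0 ≤ p₁ ∧ τ p₁ < ∞) ∧ (0 ≤ p₂ ∧ τ p₂ < ∞) ∧ (0 ≤ p₃ ∧ τ p₃ < ∞) ∧ (0 ≤ p₄ ∧ τ p₄ < ∞) ∧
    z = (p₁ - p₂) + Complex.I • (p₃ - p₄) ∧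
    c = ((τ p₁).toReal - (τ p₂).toReal : ℂ) + Complex.I * ((τ p₃).toReal - (τ p₄).toReal : ℂ)

/-- A map between von Neumann algebras with traces is trace preserving if `τ₂ ∘ J = τ₁` on the
positive cone. -/
def IsTracePreserving {S : VonNeumannAlgebra H} {R : VonNeumannAlgebra K}
    (τ₁ : Elt S → ℝ≥0∞) (τ₂ : Elt R → ℝ≥0∞) (J : Elt S → Elt R) : Prop :=
  ∀ x : Elt S, 0 ≤ x → τ₂ (J x) = τ₁ x

/-- `E : R → S` is the conditional expectation `𝔼_J` associated with the trace preserving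
`*`-homomorphism `J : S → R`, i.e. the adjoint of `J₁ : L¹(S) → L¹(R)` for the trace dualities:
`τ₁(E(y) x) = τ₂(y J(x))` for all `y ∈ R` and all `x ≥ 0` in `S` with `τ₁(x) < ∞` (these `x` span a
dense subspace of `L¹(S)`). This determines `E` uniquely. -/
def IsCondExp {S : VonNeumannAlgebra H} {R : VonNeumannAlgebra K}
    (τ₁ : Elt S → ℝ≥0∞) (τ₂ : Elt R → ℝ≥0∞) (J : Elt S → Elt R) (E : Elt R → Elt S) : Prop :=
  ∀ (y : Elt R) (x : Elt S), 0 ≤ x → τ₁ x < ∞ →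
    ∃ c : ℂ, HasTrace τ₁ (E y * x) c ∧ HasTrace τ₂ (y * J x) c

/-- The operator `T` on the tracial von Neumann algebra `(S, τ)` admits an absolute dilation:
there are a tracial von Neumann algebra `(M, σ)`, a normal unital trace preserving
`*`-homomorphism `J : S → M` and a trace preserving `*`-automorphism `U` of `M` such that
`T ^ k = 𝔼_J U ^ k J` for all `k ≥ 0`. -/
def IsAbsolutelyDilatable.{u, v} {H : Type u} [NormedAddCommGroup H] [InnerProductSpace ℂ H]
    [CompleteSpace H] (S : VonNeumannAlgebra H) (τ : Elt S → ℝ≥0∞)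
    (T : Elt S →ₗ[ℂ] Elt S) : Prop :=
  IsNSFTrace S τ ∧
  ∃ (K : Type v) (_ : NormedAddCommGroup K) (_ : InnerProductSpace ℂ K) (_ : CompleteSpace K)
    (M : VonNeumannAlgebra K) (σ : Elt M → ℝ≥0∞)
    (J : Elt S →⋆ₐ[ℂ] Elt M) (U : Elt M ≃⋆ₐ[ℂ] Elt M) (E : Elt M → Elt S),
    IsNSFTrace M σ ∧
    IsNormalMap J ∧ IsTracePreserving τ σ J ∧
    IsTracePreserving σ σ U ∧
    IsCondExp τ σ J E ∧
    ∀ (k : ℕ) (x : Elt S), (T ^ k) x = E (U^[k] (J x))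

/-- The usual trace on `B(H)`, `tr x = ∑ᵢ ⟪eᵢ, x eᵢ⟫` for `x ≥ 0`, computed in some orthonormal
basis of `H` (the value does not depend on the basis). -/
def operatorTrace (x : Elt (fullAlgebra H)) : ℝ≥0∞ :=
  ∑' i, ENNReal.ofReal (RCLike.re
    ⟪(exists_hilbertBasis ℂ H).choose_spec.choose i,
      (x : H →L[ℂ] H) ((exists_hilbertBasis ℂ H).choose_spec.choose i)⟫_ℂ)

end VonNeumann

/-! ## Fourier and Schur multipliers -/

section Group

variable {G : Type*} [Group G]

open scoped ComplexOrder in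
/-- Positive definite functions on a group: all matrices `[u(tᵢ⁻¹ tⱼ)]` are positive
semidefinite. -/
def IsPosDefFun (u : G → ℂ) : Prop :=
  ∀ (n : ℕ) (t : Fin n → G), (Matrix.of fun i j => u ((t i)⁻¹ * t j)).PosSemidef

variable [TopologicalSpace G] [IsTopologicalGroup G] [MeasurableSpace G] [BorelSpace G]
variable (μ : Measure G) [μ.IsHaarMeasure]

/-- The left regular representation, `[λ(s)h](t) = h(s⁻¹t)` on `L²(G)`. -/
def leftReg (s : G) : Lp ℂ 2 μ →L[ℂ] Lp ℂ 2 μ :=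
  (Lp.compMeasurePreservingₗᵢ ℂ (fun t : G => s⁻¹ * t)
    (measurePreserving_mul_left μ s⁻¹)).toContinuousLinearMap

/-- The group von Neumann algebra `VN(G)`: the von Neumann algebra generated by the operators
`λ(t)`, that is, the double commutant of `{λ(t) : t ∈ G}`. (The operators `λ(t)`
form a group of unitaries, hence a set stable under adjoints.) -/
def groupVN : VonNeumannAlgebra (Lp ℂ 2 μ) where
  toStarSubalgebra :=
    StarSubalgebra.centralizer ℂ
      (StarSubalgebra.centralizer ℂ (Set.range (leftReg μ)) : Set (Lp ℂ 2 μ →L[ℂ] Lp ℂ 2 μ))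
  centralizer_centralizer' := by
    exact Set.centralizer_centralizer_centralizer _

theorem leftReg_mem_groupVN (s : G) : leftReg μ s ∈ (groupVN μ).toStarSubalgebra := by
  change leftReg μ s ∈ StarSubalgebra.centralizer ℂ _
  rw [StarSubalgebra.mem_centralizer_iff]
  intro x hx
  have hx1 := hx
  rw [SetLike.mem_coe, StarSubalgebra.mem_centralizer_iff] at hx1
  have hx2 := star_mem (SetLike.mem_coe.mp hx)
  rw [StarSubalgebra.mem_centralizer_iff] at hx2
  exact ⟨((hx1 _ ⟨s, rfl⟩).1).symm, ((hx2 _ ⟨s, rfl⟩).1).symm⟩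

/-- `λ(s)` as an element of `VN(G)`. -/
def leftRegVN (s : G) : Elt (groupVN μ) := ⟨leftReg μ s, leftReg_mem_groupVN μ s⟩

/-- `y = λ(f) = ∫ f(s) λ(s) ds`, the integral being taken in the strong sense. -/
def IsLeftConvolution (f : G → ℂ) (y : Lp ℂ 2 μ →L[ℂ] Lp ℂ 2 μ) : Prop :=
  ∀ g : Lp ℂ 2 μ, y g = ∫ s, f s • leftReg μ s g ∂μ

/-- The Plancherel trace on `VN(G)`, for a compact group `G`:
`τ_G(y* y) = ‖f‖₂²` if `y = λ(f)` for some `f ∈ L²(G)`, and `τ_G(x) = ∞` if the positive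
element `x` is not of the form `λ(f)* λ(f)` with `f ∈ L²(G)`. (As `G` is compact,
`L²(G) ⊆ L¹(G)`, so that `λ(f)` is a bounded operator for each `f ∈ L²(G)`.) -/
def plancherelTrace (x : Elt (groupVN μ)) : ℝ≥0∞ :=
  ⨅ (f : Lp ℂ 2 μ) (_ : ∃ y : Lp ℂ 2 μ →L[ℂ] Lp ℂ 2 μ,
    IsLeftConvolution μ f y ∧ (x : Lp ℂ 2 μ →L[ℂ] Lp ℂ 2 μ) = star y * y),
    ENNReal.ofReal (‖f‖ ^ 2)

/-- `M` is the Fourier multiplier `M_u` on `VN(G)`: it is normal and `M(λ(t)) = u(t) λ(t)`. -/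
def IsFourierMultiplier (u : G → ℂ) (M : Elt (groupVN μ) →ₗ[ℂ] Elt (groupVN μ)) : Prop :=
  IsNormalMap M ∧ ∀ t : G, M (leftRegVN μ t) = u t • leftRegVN μ t

end Group

section Schur

variable {Ω : Type*} [MeasurableSpace Ω] (μ : Measure Ω)

/-- `x` is the (Hilbert-Schmidt) integral operator on `L²(Ω)` with kernel `F`,
`[x g](s) = ∫ F(s,t) g(t) dt`. -/
def HasKernel (F : Ω × Ω → ℂ) (x : Lp ℂ 2 μ →L[ℂ] Lp ℂ 2 μ) : Prop :=
  ∀ g : Lp ℂ 2 μ, ∀ᵐ s ∂μ, x g s = ∫ t, F (s, t) * g t ∂μ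

/-- `T` is the Schur multiplier `T_φ` on `B(L²(Ω))`: it is normal and maps
the operator with kernel `F` to the operator with kernel `φ F`, for each `F ∈ L²(Ω × Ω)`. -/
def IsSchurMultiplier (φ : Ω → Ω → ℂ)
    (T : Elt (fullAlgebra (Lp ℂ 2 μ)) →ₗ[ℂ] Elt (fullAlgebra (Lp ℂ 2 μ))) : Prop :=
  IsNormalMap T ∧
  ∀ (F : Ω × Ω → ℂ), MemLp F 2 (μ.prod μ) → ∀ x : Elt (fullAlgebra (Lp ℂ 2 μ)),
    HasKernel μ F x → HasKernel μ (fun p => φ p.1 p.2 * F p) (T x)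

end Schur

end AbsDilation

end

universe u v

/-!
For a compact group `G` the group von Neumann algebra `VN(G)` sits inside `B(L²(G))` as a tracial
subalgebra with a conditional expectation, and the Schur multiplier with symbol `u(st⁻¹)` extends
the Fourier multiplier with symbol `u`. An absolute dilation `(N, J, U)` of the former therefore
restricts to one of the latter: `J` is composed with the inclusion, and the conditional
expectation of `N` onto `B(L²(G))` with that of `B(L²(G))` onto `VN(G)`. Four facts carry this.

* The commutation theorem `mem_groupVN_iff_commute_rightReg`: `VN(G)` is the commutant of the right
  regular representation `ρ`. An operator `x` commuting with `ρ` satisfies `xλ(h) = λ(xh)`, and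
  the operators `λ(h)` commute with the commutant of `λ`.
* The Plancherel trace is the restriction of the usual trace (`plancherelTrace_eq_posTrace`). The
  formula `tr(λ(f)* λ(f)) = ‖f‖²` is Parseval's identity, integrated over `G` by means of Dini's
  theorem as the orthonormal basis may be uncountable. Conversely a Hilbert-Schmidt operator in
  `VN(G)` is some `λ(f)`, by the Riesz representation theorem. Normality of the restricted trace
  holds since suprema of bounded directed families in `VN(G)` are weak limits and agree with the
  suprema in `B(L²(G))`; semifiniteness holds since `vλ(k)λ(k)*v ≤ v²` has finite trace if
  `‖λ(k)‖ ≤ 1`.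
* The average `z ↦ ∫ ρ(t) z ρ(t)⁻¹ dt` maps `B(L²(G))` onto `VN(G)`, fixes `VN(G)`, and satisfies
  `τ(avg(z) x) = tr(z x)` for positive `x ∈ VN(G)` of finite trace (`hasTrace_averageVN_mul`):
  with `x = v²`, all traces involved are traces of products of Hilbert-Schmidt operators, so that
  sum and integral may be interchanged.
* The Schur multiplier `T` maps `λ(s)` to `u(s)λ(s)` (`IsSchurMultiplier.apply_leftReg`). For
  continuous `h`, the operator `λ(h)` has kernel `h(st⁻¹)`, so `T(λ(h)) = λ(uh)`; as `T` is normal,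
  both sides are strong integrals against `h`, and one compares integrands. As the `λ(s)` span an
  ultraweakly dense subspace of `VN(G)` (`eq_zero_of_leftRegVN_eq_zero`), `T` maps `VN(G)` into
  itself and is there the Fourier multiplier.
-/

namespace AbsDilation

set_option linter.unusedSectionVars false

/-! ### Invariance of the Haar measure of a compact group -/

section Haar

variable {G : Type*} [Group G] [TopologicalSpace G] [IsTopologicalGroup G] [CompactSpace G]
  [MeasurableSpace G] [BorelSpace G]
  (μ : Measure G) [μ.IsHaarMeasure] [IsProbabilityMeasure μ]

/-- Compact groups are unimodular. -/
instance isMulRightInvariant_of_compactSpace : μ.IsMulRightInvariant where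
  map_mul_right_eq_self g := by
    have : IsProbabilityMeasure (μ.map (· * g)) :=
      Measure.isProbabilityMeasure_map (measurable_mul_const g).aemeasurable
    exact Measure.isHaarMeasure_eq_of_isProbabilityMeasure _ _

instance isInvInvariant_of_compactSpace : μ.IsInvInvariant where
  inv_eq_self := by
    have hp : IsProbabilityMeasure μ.inv :=
      Measure.isProbabilityMeasure_map measurable_inv.aemeasurable
    have h := Measure.isMulInvariant_eq_smul_of_compactSpace μ.inv μ
    have h1 := congrArg (fun ν : Measure G => ν Set.univ) h
    simp only [measure_univ, Measure.smul_apply, ENNReal.smul_def, smul_eq_mul, mul_one] at h1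
    rw [h, ENNReal.smul_def, ← h1, one_smul]

end Haar

/-! ### Strong integrals of operator-valued functions -/

section Integral

variable {X : Type*} [MeasurableSpace X] {μ : Measure X} [IsProbabilityMeasure μ]
  {E : Type*} [NormedAddCommGroup E] [NormedSpace ℂ E]

theorem integrable_of_memLp_two (f : Lp ℂ 2 μ) : Integrable f μ :=
  (Lp.memLp f).integrable (by norm_num)

theorem integral_norm_le_norm (f : Lp ℂ 2 μ) : ∫ s, ‖f s‖ ∂μ ≤ ‖f‖ := by
  rw [integral_norm_eq_lintegral_enorm (Lp.aestronglyMeasurable f), Lp.norm_def]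
  refine ENNReal.toReal_mono (Lp.eLpNorm_ne_top f) ?_
  rw [← eLpNorm_one_eq_lintegral_enorm]
  exact eLpNorm_le_eLpNorm_of_exponent_le (by norm_num) (Lp.aestronglyMeasurable f)

variable [TopologicalSpace X] [CompactSpace X] [OpensMeasurableSpace X]

theorem aestronglyMeasurable_of_continuous {F : Type*} [TopologicalSpace F]
    [TopologicalSpace.PseudoMetrizableSpace F] {g : X → F} (hg : Continuous g) :
    AEStronglyMeasurable g μ := by
  have := hg.continuousOn.aestronglyMeasurable_of_isCompact (μ := μ) isCompact_univ .univ
  rwa [Measure.restrict_univ] at this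

theorem integrable_smul_of_continuous (f : Lp ℂ 2 μ) {g : X → E} (hg : Continuous g) :
    Integrable (fun s => f s • g s) μ := by
  obtain ⟨C, hC⟩ := (isCompact_range hg).isBounded.exists_norm_le
  exact (integrable_of_memLp_two f).smul_bdd C (aestronglyMeasurable_of_continuous hg)
    (ae_of_all _ fun s => hC _ ⟨s, rfl⟩)

theorem norm_integral_smul_le (f : Lp ℂ 2 μ) {g : X → E} {C : ℝ} (hC : ∀ s, ‖g s‖ ≤ C) :
    ‖∫ s, f s • g s ∂μ‖ ≤ ‖f‖ * C := by
  obtain ⟨x⟩ : Nonempty X := nonempty_of_isProbabilityMeasure μ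
  have hC0 : 0 ≤ C := (norm_nonneg _).trans (hC x)
  calc ‖∫ s, f s • g s ∂μ‖ ≤ ∫ s, ‖f s‖ * C ∂μ := by
        refine norm_integral_le_of_norm_le ((integrable_of_memLp_two f).norm.mul_const C)
          (ae_of_all _ fun s => ?_)
        rw [norm_smul]
        exact mul_le_mul_of_nonneg_left (hC s) (norm_nonneg _)
    _ ≤ ‖f‖ * C := by
        rw [integral_mul_const]
        exact mul_le_mul_of_nonneg_right (integral_norm_le_norm f) hC0

variable {K : Type*} [NormedAddCommGroup K] [InnerProductSpace ℂ K] [CompleteSpace K]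

theorem exists_norm_le_of_strongly_continuous {F : X → K →L[ℂ] K}
    (hF : ∀ ξ, Continuous fun s => F s ξ) : ∃ C, ∀ s, ‖F s‖ ≤ C := by
  refine banach_steinhaus fun ξ => ?_
  obtain ⟨C, hC⟩ := (isCompact_range (hF ξ)).isBounded.exists_norm_le
  exact ⟨C, fun s => hC _ ⟨s, rfl⟩⟩

variable (μ) in
/-- For a strongly continuous operator-valued function `F` on a compact probability space, the
operators `∫ f(s) F(s) ds` (strong integrals), as a bounded linear function of `f ∈ L²`. -/
noncomputable def opIntegral (F : X → K →L[ℂ] K) (hF : ∀ ξ, Continuous fun s => F s ξ) :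
    Lp ℂ 2 μ →L[ℂ] K →L[ℂ] K :=
  LinearMap.mkContinuous₂
    (LinearMap.mk₂ ℂ (fun (f : Lp ℂ 2 μ) ξ => ∫ s, f s • F s ξ ∂μ)
      (fun f g ξ => by
        rw [← integral_add (integrable_smul_of_continuous f (hF ξ))
          (integrable_smul_of_continuous g (hF ξ))]
        refine integral_congr_ae ?_
        filter_upwards [Lp.coeFn_add f g] with s hs
        simp only [hs, Pi.add_apply, add_smul])
      (fun c f ξ => by
        rw [← integral_smul]
        refine integral_congr_ae ?_
        filter_upwards [Lp.coeFn_smul c f] with s hs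
        simp [hs, smul_smul])
      (fun f ξ η => by
        rw [← integral_add (integrable_smul_of_continuous f (hF ξ))
          (integrable_smul_of_continuous f (hF η))]
        simp)
      (fun c f ξ => by
        rw [← integral_smul]
        simp [smul_comm c]))
    (exists_norm_le_of_strongly_continuous hF).choose
    (fun f ξ => by
      refine (norm_integral_smul_le f fun s => ((F s).le_opNorm ξ).trans
        (mul_le_mul_of_nonneg_right ((exists_norm_le_of_strongly_continuous hF).choose_spec s)
          (norm_nonneg ξ))).trans (le_of_eq ?_)
      ring)

variable {F : X → K →L[ℂ] K} (hF : ∀ ξ, Continuous fun s => F s ξ)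

theorem opIntegral_apply (f : Lp ℂ 2 μ) (ξ : K) :
    opIntegral μ F hF f ξ = ∫ s, f s • F s ξ ∂μ := rfl

theorem map_opIntegral_apply (L : K →L[ℂ] E) [CompleteSpace E] (f : Lp ℂ 2 μ) (ξ : K) :
    L (opIntegral μ F hF f ξ) = ∫ s, f s • L (F s ξ) ∂μ := by
  rw [opIntegral_apply, ← L.integral_comp_comm (integrable_smul_of_continuous f (hF ξ))]
  simp

theorem inner_opIntegral (f : Lp ℂ 2 μ) (η ξ : K) :
    ⟪η, opIntegral μ F hF f ξ⟫_ℂ = ∫ s, f s * ⟪η, F s ξ⟫_ℂ ∂μ :=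
  map_opIntegral_apply hF (innerSL ℂ η) f ξ

/-- An operator commuting with all `F(s)` commutes with `∫ f(s) F(s) ds`. -/
theorem commute_opIntegral {a : K →L[ℂ] K} (ha : ∀ s, a * F s = F s * a) (f : Lp ℂ 2 μ) :
    a * opIntegral μ F hF f = opIntegral μ F hF f * a := by
  ext ξ
  rw [mul_apply_eq_comp, mul_apply_eq_comp, map_opIntegral_apply,
    opIntegral_apply]
  refine integral_congr_ae (ae_of_all _ fun s => ?_)
  simpa using congrArg (f s • ·) (DFunLike.congr_fun (ha s) ξ)

/-- Term by term integration of a dominated series of continuous functions. The index set may be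
uncountable, so this is not an instance of dominated convergence; instead the series converges in
`C(X, ℂ)`, on which integration against `f ∈ L²` is a bounded functional. -/
theorem hasSum_integral_mul_of_summable {ι : Type*} {g : ι → X → ℂ} (hg : ∀ i, Continuous (g i))
    {b : ι → ℝ} (hb : Summable b) (hgb : ∀ i s, ‖g i s‖ ≤ b i) (f : Lp ℂ 2 μ) :
    HasSum (fun i => ∫ s, f s * g i s ∂μ) (∫ s, f s * ∑' i, g i s ∂μ) := by
  obtain ⟨x⟩ : Nonempty X := nonempty_of_isProbabilityMeasure μ
  let L : C(X, ℂ) →L[ℂ] ℂ := LinearMap.mkContinuous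
    { toFun := fun h => ∫ s, f s • h s ∂μ
      map_add' := fun h k => by
        rw [← integral_add (integrable_smul_of_continuous f h.continuous)
          (integrable_smul_of_continuous f k.continuous)]
        simp [mul_add]
      map_smul' := fun c h => by
        rw [RingHom.id_apply, ← integral_smul]
        simp [mul_left_comm] } ‖f‖ (fun h => norm_integral_smul_le f h.norm_coe_le_norm)
  let k : ι → C(X, ℂ) := fun i => ⟨g i, hg i⟩
  have hk : Summable k := Summable.of_norm_bounded hb fun i =>
    (ContinuousMap.norm_le _ ((norm_nonneg _).trans (hgb i x))).2 (hgb i)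
  have h1 := hk.hasSum.mapL L
  have h2 : ∀ s, (∑' i, k i) s = ∑' i, g i s := fun s =>
    (ContinuousMap.hasSum_apply hk.hasSum s).tsum_eq.symm
  have h3 : L (∑' i, k i) = ∫ s, f s * ∑' i, g i s ∂μ := by
    change ∫ s, f s • (∑' i, k i) s ∂μ = _
    simp only [h2, smul_eq_mul]
  rw [h3] at h1
  exact h1

end Integral

/-! ### The regular representations and convolution operators -/

section Regular

variable {G : Type*} [Group G] [TopologicalSpace G] [IsTopologicalGroup G] [CompactSpace G]
  [T2Space G] [MeasurableSpace G] [BorelSpace G]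
  (μ : Measure G) [μ.IsHaarMeasure] [IsProbabilityMeasure μ]

/-- The right regular representation, `[ρ(s)h](t) = h(ts)` on `L²(G)`. -/
noncomputable def rightReg (s : G) : Lp ℂ 2 μ →L[ℂ] Lp ℂ 2 μ :=
  (Lp.compMeasurePreservingₗᵢ ℂ (fun t : G => t * s)
    (measurePreserving_mul_right μ s)).toContinuousLinearMap

/-- The class in `L²(G)` of a continuous function. -/
noncomputable abbrev toL2 : C(G, ℂ) →L[ℂ] Lp ℂ 2 μ := ContinuousMap.toLp 2 μ ℂ

theorem coeFn_toL2 (h : C(G, ℂ)) : toL2 μ h =ᵐ[μ] h := ContinuousMap.coeFn_toLp μ h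

theorem denseRange_toL2 : DenseRange (toL2 μ) :=
  ContinuousMap.toLp_denseRange ℂ μ ℂ (by norm_num)

theorem continuous_leftReg (g : Lp ℂ 2 μ) : Continuous fun s => leftReg μ s g := by
  have hc : Continuous fun s : G => (⟨fun t => s⁻¹ * t, by fun_prop⟩ : C(G, G)) :=
    ContinuousMap.continuous_of_continuous_uncurry _ (by
      simp only [Function.uncurry_def, ContinuousMap.coe_mk]; fun_prop)
  exact Continuous.compMeasurePreservingLp continuous_const hc
    (fun s => measurePreserving_mul_left μ s⁻¹) (by norm_num)

theorem continuous_rightReg (g : Lp ℂ 2 μ) : Continuous fun s => rightReg μ s g := by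
  have hc : Continuous fun s : G => (⟨fun t => t * s, by fun_prop⟩ : C(G, G)) :=
    ContinuousMap.continuous_of_continuous_uncurry _ (by
      simp only [Function.uncurry_def, ContinuousMap.coe_mk]; fun_prop)
  exact Continuous.compMeasurePreservingLp continuous_const hc
    (fun s => measurePreserving_mul_right μ s) (by norm_num)

theorem continuous_rightReg_inv (g : Lp ℂ 2 μ) : Continuous fun s => rightReg μ s⁻¹ g :=
  (continuous_rightReg μ g).comp continuous_inv

theorem leftReg_mul (s t : G) : leftReg μ s * leftReg μ t = leftReg μ (s * t) := by
  ext1 g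
  change Lp.compMeasurePreserving _ _ (Lp.compMeasurePreserving _ _ g) =
    Lp.compMeasurePreserving _ _ g
  rw [← Lp.compMeasurePreserving_comp_apply]
  congr 2
  ext x
  simp [mul_assoc]

theorem rightReg_mul (s t : G) : rightReg μ s * rightReg μ t = rightReg μ (s * t) := by
  ext1 g
  change Lp.compMeasurePreserving _ _ (Lp.compMeasurePreserving _ _ g) =
    Lp.compMeasurePreserving _ _ g
  rw [← Lp.compMeasurePreserving_comp_apply]
  congr 2
  ext x
  simp [mul_assoc]

theorem leftReg_one : leftReg μ (1 : G) = 1 := by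
  ext1 g
  refine Eq.trans ?_ (Lp.compMeasurePreserving_id_apply g)
  change Lp.compMeasurePreserving _ _ g = _
  congr 2
  ext x
  simp

theorem rightReg_one : rightReg μ (1 : G) = 1 := by
  ext1 g
  refine Eq.trans ?_ (Lp.compMeasurePreserving_id_apply g)
  change Lp.compMeasurePreserving _ _ g = _
  congr 2
  ext x
  simp

theorem leftReg_mul_rightReg (s t : G) :
    leftReg μ s * rightReg μ t = rightReg μ t * leftReg μ s := by
  ext1 g
  change Lp.compMeasurePreserving _ _ (Lp.compMeasurePreserving _ _ g) =
    Lp.compMeasurePreserving _ _ (Lp.compMeasurePreserving _ _ g)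
  rw [← Lp.compMeasurePreserving_comp_apply, ← Lp.compMeasurePreserving_comp_apply]
  congr 2
  ext x
  simp [mul_assoc]

theorem norm_leftReg_apply (s : G) (g : Lp ℂ 2 μ) : ‖leftReg μ s g‖ = ‖g‖ :=
  Lp.norm_compMeasurePreserving g _

theorem norm_rightReg_apply (s : G) (g : Lp ℂ 2 μ) : ‖rightReg μ s g‖ = ‖g‖ :=
  Lp.norm_compMeasurePreserving g _

theorem star_eq_of_isometry_of_mul_eq_one {K : Type*} [NormedAddCommGroup K]
    [InnerProductSpace ℂ K] [CompleteSpace K] {a b : K →L[ℂ] K} (ha : ∀ ξ, ‖a ξ‖ = ‖ξ‖)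
    (hab : a * b = 1) : star a = b := by
  have h : star a * a = 1 := (ContinuousLinearMap.norm_map_iff_adjoint_comp_self a).1 ha
  calc star a = star a * (a * b) := by rw [hab, mul_one]
    _ = b := by rw [← mul_assoc, h, one_mul]

theorem star_leftReg (s : G) : star (leftReg μ s) = leftReg μ s⁻¹ :=
  star_eq_of_isometry_of_mul_eq_one (norm_leftReg_apply μ s) (by
    rw [leftReg_mul, mul_inv_cancel, leftReg_one])

theorem star_rightReg (s : G) : star (rightReg μ s) = rightReg μ s⁻¹ :=
  star_eq_of_isometry_of_mul_eq_one (norm_rightReg_apply μ s) (by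
    rw [rightReg_mul, mul_inv_cancel, rightReg_one])

/-- The left convolution operators `λ(f) = ∫ f(s) λ(s) ds`, for `f ∈ L²(G)`. -/
noncomputable def leftConv : Lp ℂ 2 μ →L[ℂ] Lp ℂ 2 μ →L[ℂ] Lp ℂ 2 μ :=
  opIntegral μ (leftReg μ) (continuous_leftReg μ)

theorem rightReg_toL2 (s : G) (h : C(G, ℂ)) :
    rightReg μ s (toL2 μ h) = toL2 μ (h.comp ⟨fun t => t * s, by fun_prop⟩) := rfl

theorem leftReg_toL2 (s : G) (h : C(G, ℂ)) :
    leftReg μ s (toL2 μ h) = toL2 μ (h.comp ⟨fun t => s⁻¹ * t, by fun_prop⟩) := rfl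

theorem integral_toL2_mul (h : C(G, ℂ)) (f : G → ℂ) :
    ∫ s, toL2 μ h s * f s ∂μ = ∫ s, h s * f s ∂μ := by
  refine integral_congr_ae ?_
  filter_upwards [coeFn_toL2 μ h] with s hs
  rw [hs]

theorem integral_integral_swap_of_continuous {f : G → G → ℂ} (hf : Continuous f.uncurry) :
    ∫ x, (∫ y, f x y ∂μ) ∂μ = ∫ y, (∫ x, f x y ∂μ) ∂μ :=
  integral_integral_swap_of_hasCompactSupport hf (HasCompactSupport.of_compactSpace _)

/-- The substitution `s ↦ ts⁻¹` in the integral defining a convolution product. -/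
theorem leftConv_apply_eq_opIntegral_rightReg (h g : Lp ℂ 2 μ) :
    leftConv μ h g =
      opIntegral μ (fun s => rightReg μ s⁻¹) (continuous_rightReg_inv μ) g h := by
  set R := opIntegral μ (fun s => rightReg μ s⁻¹) (continuous_rightReg_inv μ) with hR
  refine (denseRange_toL2 μ).induction_on₂ (p := fun h g => leftConv μ h g = R g h) ?_ ?_ h g
  · exact isClosed_eq
      ((leftConv μ).continuous.comp continuous_fst |>.clm_apply continuous_snd)
      (R.continuous.comp continuous_snd |>.clm_apply continuous_fst)
  intro h g
  refine ext_inner_left ℂ fun k => ?_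
  refine (denseRange_toL2 μ).induction_on
    (p := fun k => ⟪k, leftConv μ (toL2 μ h) (toL2 μ g)⟫_ℂ = ⟪k, R (toL2 μ g) (toL2 μ h)⟫_ℂ) k
    (isClosed_eq (by fun_prop) (by fun_prop)) fun k => ?_
  rw [leftConv, hR, inner_opIntegral, inner_opIntegral, integral_toL2_mul, integral_toL2_mul]
  simp only [leftReg_toL2, rightReg_toL2, toL2, ContinuousMap.inner_toLp]
  simp only [← integral_const_mul]
  refine (integral_integral_swap_of_continuous μ (by
    simp only [Function.uncurry_def, ContinuousMap.comp_apply, ContinuousMap.coe_mk]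
    fun_prop)).trans (Eq.trans ?_ (integral_integral_swap_of_continuous μ (by
      simp only [Function.uncurry_def, ContinuousMap.comp_apply, ContinuousMap.coe_mk]
      fun_prop)).symm)
  refine integral_congr_ae (ae_of_all _ fun t => ?_)
  beta_reduce
  rw [← integral_mul_left_eq_self _ t]
  refine (integral_inv_eq_self _ μ).symm.trans (integral_congr_ae (ae_of_all _ fun s => ?_))
  simp
  ring

/-- For continuous `h`, the operator `λ(h)` is the integral operator with kernel `h(st⁻¹)`; its
range consists of continuous functions. -/
theorem exists_continuousMap_leftConv (h : C(G, ℂ)) (g : Lp ℂ 2 μ) :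
    ∃ k : C(G, ℂ), leftConv μ (toL2 μ h) g = toL2 μ k ∧
      ∀ s, k s = ∫ t, g t * h (s * t⁻¹) ∂μ := by
  let κ : G → C(G, ℂ) := fun t => h.comp ⟨fun s => s * t⁻¹, by fun_prop⟩
  have hκ : Continuous κ := ContinuousMap.continuous_of_continuous_uncurry _ (by
    simp only [Function.uncurry_def, κ, ContinuousMap.comp_apply, ContinuousMap.coe_mk]; fun_prop)
  refine ⟨∫ t, g t • κ t ∂μ, ?_, fun s => ?_⟩
  · rw [leftConv_apply_eq_opIntegral_rightReg, opIntegral_apply,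
      ← (toL2 μ).integral_comp_comm (integrable_smul_of_continuous g hκ)]
    refine integral_congr_ae (ae_of_all _ fun t => ?_)
    simp only [map_smul]
    rfl
  · exact ((ContinuousMap.evalCLM ℂ s).integral_comp_comm
      (integrable_smul_of_continuous g hκ)).symm

/-- Test functions separate continuous functions. -/
theorem eq_zero_of_integral_mul_eq_zero {f : G → ℂ} (hf : Continuous f)
    (h0 : ∀ h : C(G, ℂ), ∫ s, toL2 μ h s * f s ∂μ = 0) (s : G) : f s = 0 := by
  -- test against the conjugate of `f`
  have h1 := h0 ⟨fun s => star (f s), by fun_prop⟩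
  rw [integral_toL2_mul] at h1
  simp only [ContinuousMap.coe_mk] at h1
  have h2 : ∀ s, star (f s) * f s = ((‖f s‖ ^ 2 : ℝ) : ℂ) := fun s => by
    rw [Complex.star_def, Complex.conj_mul', Complex.ofReal_pow]
  simp only [h2] at h1
  rw [integral_complex_ofReal] at h1
  have hc : Continuous fun s => ‖f s‖ ^ 2 := by fun_prop
  have h3 := (integral_eq_zero_iff_of_nonneg (fun s => by positivity)
    (hc.integrable_of_hasCompactSupport (HasCompactSupport.of_compactSpace _))).1
    (by exact_mod_cast h1)
  have h4 := (Continuous.ae_eq_iff_eq μ hc continuous_zero).1 h3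
  simpa using congrFun h4 s

theorem eq_of_integral_mul_eq {f g : G → ℂ} (hf : Continuous f) (hg : Continuous g)
    (h0 : ∀ h : C(G, ℂ), ∫ s, toL2 μ h s * f s ∂μ = ∫ s, toL2 μ h s * g s ∂μ) (s : G) :
    f s = g s := by
  refine sub_eq_zero.1 (eq_zero_of_integral_mul_eq_zero μ (f := fun s => f s - g s) (hf.sub hg)
    (fun h => ?_) s)
  have h1 := integral_sub (integrable_smul_of_continuous (toL2 μ h) hf)
    (integrable_smul_of_continuous (toL2 μ h) hg)
  simp only [smul_eq_mul, ← mul_sub] at h1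
  rw [h1, h0, sub_self]

/-- The operators `λ(h)`, `h` continuous, act nondegenerately. -/
theorem eq_zero_of_mul_leftConv_eq_zero {a : Lp ℂ 2 μ →L[ℂ] Lp ℂ 2 μ}
    (ha : ∀ h : C(G, ℂ), a * leftConv μ (toL2 μ h) = 0) : a = 0 := by
  ext1 ξ
  refine ext_inner_left ℂ fun η => ?_
  have h := eq_zero_of_integral_mul_eq_zero μ (f := fun s => ⟪η, a (leftReg μ s ξ)⟫_ℂ)
    (continuous_const.inner (a.continuous.comp (continuous_leftReg μ ξ))) (fun h => ?_) 1
  · simpa [leftReg_one] using h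
  · have h1 := map_opIntegral_apply (continuous_leftReg μ)
      ((innerSL ℂ η).comp a) (toL2 μ h) ξ
    have h2 := DFunLike.congr_fun (ha h) ξ
    rw [mul_apply_eq_comp] at h2
    simp only [ContinuousLinearMap.comp_apply, innerSL_apply_apply, smul_eq_mul] at h1
    rw [← h1]
    change ⟪η, a (leftConv μ (toL2 μ h) ξ)⟫_ℂ = 0
    rw [h2]
    simp

/-- An operator commuting with right translations maps convolution operators to convolution
operators. -/
theorem mul_leftConv_of_commute {a : Lp ℂ 2 μ →L[ℂ] Lp ℂ 2 μ}
    (ha : ∀ s, a * rightReg μ s = rightReg μ s * a) (h : Lp ℂ 2 μ) :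
    a * leftConv μ h = leftConv μ (a h) := by
  ext1 g
  rw [mul_apply_eq_comp, leftConv_apply_eq_opIntegral_rightReg,
    leftConv_apply_eq_opIntegral_rightReg]
  exact DFunLike.congr_fun (commute_opIntegral (continuous_rightReg_inv μ) (fun s => ha s⁻¹) g) h

theorem star_leftConv (h : C(G, ℂ)) : ∃ k, star (leftConv μ (toL2 μ h)) = leftConv μ k := by
  refine ⟨toL2 μ ⟨fun s => star (h s⁻¹), by fun_prop⟩, ?_⟩
  ext1 ξ
  refine ext_inner_left ℂ fun η => ?_
  rw [ContinuousLinearMap.star_eq_adjoint, ContinuousLinearMap.adjoint_inner_right,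
    ← inner_conj_symm]
  simp only [leftConv, inner_opIntegral]
  rw [integral_toL2_mul, integral_toL2_mul, ← integral_conj, ← integral_inv_eq_self]
  refine integral_congr_ae (ae_of_all _ fun s => ?_)
  simp only [map_mul, inner_conj_symm, ContinuousMap.coe_mk, Complex.star_def]
  rw [← star_leftReg, ContinuousLinearMap.star_eq_adjoint, ContinuousLinearMap.adjoint_inner_left]

theorem isLeftConvolution_iff {f : Lp ℂ 2 μ} {y : Lp ℂ 2 μ →L[ℂ] Lp ℂ 2 μ} :
    IsLeftConvolution μ f y ↔ y = leftConv μ f :=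
  ⟨fun h => ContinuousLinearMap.ext h, fun h g => by rw [h]; rfl⟩

/-! ### The commutation theorem -/

theorem mem_groupVN_iff {x : Lp ℂ 2 μ →L[ℂ] Lp ℂ 2 μ} :
    x ∈ (groupVN μ).toStarSubalgebra ↔
      ∀ c, (∀ s, c * leftReg μ s = leftReg μ s * c) → c * x = x * c := by
  change x ∈ StarSubalgebra.centralizer ℂ _ ↔ _
  rw [StarSubalgebra.mem_centralizer_iff]
  constructor
  · intro h c hc
    refine (h c ?_).1
    rw [SetLike.mem_coe, StarSubalgebra.mem_centralizer_iff]
    rintro _ ⟨s, rfl⟩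
    rw [star_leftReg]
    exact ⟨(hc s).symm, (hc s⁻¹).symm⟩
  · intro h c hc
    have key : ∀ c ∈ StarSubalgebra.centralizer ℂ (Set.range (leftReg μ)),
        c * x = x * c := fun c hc => h c fun s => by
      rw [StarSubalgebra.mem_centralizer_iff] at hc
      exact ((hc _ ⟨s, rfl⟩).1).symm
    exact ⟨key c hc, key (star c) (star_mem (SetLike.mem_coe.1 hc))⟩

theorem leftConv_mem_groupVN (f : Lp ℂ 2 μ) : leftConv μ f ∈ (groupVN μ).toStarSubalgebra :=
  (mem_groupVN_iff μ).2 fun _ hc => commute_opIntegral (continuous_leftReg μ) hc f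

/-- The commutation theorem: `VN(G)` is the commutant of the right regular representation. -/
theorem mem_groupVN_iff_commute_rightReg {x : Lp ℂ 2 μ →L[ℂ] Lp ℂ 2 μ} :
    x ∈ (groupVN μ).toStarSubalgebra ↔ ∀ s, x * rightReg μ s = rightReg μ s * x := by
  constructor
  · intro hx s
    exact ((mem_groupVN_iff μ).1 hx _ fun t => (leftReg_mul_rightReg μ t s).symm).symm
  · intro hx
    rw [mem_groupVN_iff]
    intro c hc
    rw [← sub_eq_zero]
    refine eq_zero_of_mul_leftConv_eq_zero μ fun h => ?_
    have hc' : ∀ k, c * leftConv μ k = leftConv μ k * c := fun k =>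
      commute_opIntegral (continuous_leftReg μ) hc k
    -- both `λ(h)` and `x λ(h) = λ(xh)` are convolution operators, hence commute with `c`
    rw [sub_mul, mul_assoc, mul_leftConv_of_commute μ hx, hc', ← mul_leftConv_of_commute μ hx,
      mul_assoc, mul_assoc, hc', sub_self]

end Regular

/-! ### Ultraweakly continuous functionals -/

section Ultraweak

variable {H : Type*} [NormedAddCommGroup H] [InnerProductSpace ℂ H] [CompleteSpace H]
variable {K : Type*} [NormedAddCommGroup K] [InnerProductSpace ℂ K] [CompleteSpace K]

/-- Pairs of square summable sequences of vectors, which index the functionals defining the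
ultraweak topology. -/
abbrev SqSummablePair (H : Type*) [NormedAddCommGroup H] : Type _ :=
  {p : (ℕ → H) × (ℕ → H) // (Summable fun n => ‖p.1 n‖ ^ 2) ∧ Summable fun n => ‖p.2 n‖ ^ 2}

theorem norm_inner_apply_le (a : H →L[ℂ] H) (ξ η : H) :
    ‖⟪η, a ξ⟫_ℂ‖ ≤ ‖a‖ * (‖ξ‖ ^ 2 + ‖η‖ ^ 2) := by
  have h1 : ‖⟪η, a ξ⟫_ℂ‖ ≤ ‖η‖ * (‖a‖ * ‖ξ‖) := (norm_inner_le_norm _ _).trans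
    (mul_le_mul_of_nonneg_left (a.le_opNorm ξ) (norm_nonneg _))
  have h2 : ‖η‖ * ‖ξ‖ ≤ ‖ξ‖ ^ 2 + ‖η‖ ^ 2 := by
    nlinarith [sq_nonneg (‖ξ‖ - ‖η‖), sq_nonneg ‖ξ‖, sq_nonneg ‖η‖]
  calc _ ≤ _ := h1
    _ = ‖a‖ * (‖η‖ * ‖ξ‖) := by ring
    _ ≤ _ := mul_le_mul_of_nonneg_left h2 (norm_nonneg _)

theorem SqSummablePair.summable_add (p : SqSummablePair H) :
    Summable fun n => ‖p.1.1 n‖ ^ 2 + ‖p.1.2 n‖ ^ 2 := p.2.1.add p.2.2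

theorem SqSummablePair.summable_inner (p : SqSummablePair H) (a : H →L[ℂ] H) :
    Summable fun n => ⟪p.1.2 n, a (p.1.1 n)⟫_ℂ :=
  Summable.of_norm_bounded (p.summable_add.mul_left ‖a‖) fun _ => norm_inner_apply_le _ _ _

/-- The functional `x ↦ ∑ₙ ⟪ηₙ, x ξₙ⟫` on a von Neumann algebra. -/
noncomputable def sumFunctional (S : VonNeumannAlgebra H) (p : SqSummablePair H) :
    Elt S →ₗ[ℂ] ℂ where
  toFun x := ∑' n, ⟪p.1.2 n, (x : H →L[ℂ] H) (p.1.1 n)⟫_ℂ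
  map_add' x y := by
    rw [← (p.summable_inner x).tsum_add (p.summable_inner y)]
    simp
  map_smul' c x := by
    rw [RingHom.id_apply, smul_eq_mul, ← (p.summable_inner x).tsum_mul_left]
    simp

theorem ultraweakTopology_eq_iInf (S : VonNeumannAlgebra H) :
    ultraweakTopology S =
      ⨅ p : SqSummablePair H, TopologicalSpace.induced (sumFunctional S p) inferInstance := by
  rw [iInf_subtype, iInf_prod]
  simp only [iInf_and]
  rfl

theorem continuous_sumFunctional (S : VonNeumannAlgebra H) (p : SqSummablePair H) :
    @Continuous _ _ (ultraweakTopology S) _ (sumFunctional S p) := by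
  rw [ultraweakTopology_eq_iInf]
  exact continuous_iInf_dom continuous_induced_dom

theorem isNormalMap_iff {S : VonNeumannAlgebra H} {R : VonNeumannAlgebra K}
    {f : Elt S → Elt R} : IsNormalMap f ↔
      ∀ p, @Continuous _ _ (ultraweakTopology S) _ fun x => sumFunctional R p (f x) := by
  rw [IsNormalMap, ultraweakTopology_eq_iInf R, continuous_iInf_rng]
  refine forall_congr' fun p => ?_
  rw [continuous_induced_rng]
  rfl

theorem continuous_inner_apply (S : VonNeumannAlgebra H) (ξ η : H) :
    @Continuous _ _ (ultraweakTopology S) _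
      fun x : Elt S => ⟪η, (x : H →L[ℂ] H) ξ⟫_ℂ := by
  have hs : ∀ v : H, Summable fun n => ‖(Pi.single 0 v : ℕ → H) n‖ ^ 2 := fun v =>
    summable_of_ne_finset_zero (s := {0}) fun n hn => by
      simp [Pi.single_eq_of_ne (by simpa using hn : n ≠ 0)]
  convert continuous_sumFunctional S ⟨(Pi.single 0 ξ, Pi.single 0 η), hs ξ, hs η⟩ using 2 with x
  change _ = ∑' n, ⟪(Pi.single 0 η : ℕ → H) n, (x : H →L[ℂ] H) ((Pi.single 0 ξ : ℕ → H) n)⟫_ℂ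
  rw [tsum_eq_single 0 fun n hn => by simp [Pi.single_eq_of_ne hn]]
  simp

theorem IsNormalMap.comp {L : Type*} [NormedAddCommGroup L] [InnerProductSpace ℂ L]
    [CompleteSpace L] {S : VonNeumannAlgebra H} {R : VonNeumannAlgebra K}
    {Q : VonNeumannAlgebra L} {g : Elt R → Elt Q} {f : Elt S → Elt R} (hg : IsNormalMap g)
    (hf : IsNormalMap f) : IsNormalMap fun x => g (f x) :=
  @Continuous.comp _ _ _ (ultraweakTopology S) (ultraweakTopology R) (ultraweakTopology Q) _ _
    hg hf

/-- The functional `x ↦ ⟪η, f(x) ξ⟫` of a linear map `f` into a von Neumann algebra. -/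
noncomputable def vectorFunctional {S : VonNeumannAlgebra K} {R : VonNeumannAlgebra H}
    (f : Elt S →ₗ[ℂ] Elt R) (ξ η : H) : Elt S →ₗ[ℂ] ℂ where
  toFun x := ⟪η, (f x : H →L[ℂ] H) ξ⟫_ℂ
  map_add' x y := by
    rw [map_add, ← inner_add_right]
    rfl
  map_smul' c x := by
    rw [map_smul, RingHom.id_apply, smul_eq_mul, ← inner_smul_right]
    rfl

theorem continuous_vectorFunctional {S : VonNeumannAlgebra K} {R : VonNeumannAlgebra H}
    {f : Elt S →ₗ[ℂ] Elt R} (hf : IsNormalMap f) (ξ η : H) :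
    @Continuous _ _ (ultraweakTopology S) _ (vectorFunctional f ξ η) :=
  @Continuous.comp _ _ _ (ultraweakTopology S) (ultraweakTopology R) _ _ _
    (continuous_inner_apply R ξ η) hf

theorem vectorFunctional_apply {S : VonNeumannAlgebra K} {R : VonNeumannAlgebra H}
    (f : Elt S →ₗ[ℂ] Elt R) (ξ η : H) (x : Elt S) :
    vectorFunctional f ξ η x = ⟪η, (f x : H →L[ℂ] H) ξ⟫_ℂ := rfl

theorem continuous_vectorFunctional_sub {S : VonNeumannAlgebra K} {R R' : VonNeumannAlgebra H}
    {f : Elt S →ₗ[ℂ] Elt R} {f' : Elt S →ₗ[ℂ] Elt R'} (hf : IsNormalMap f)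
    (hf' : IsNormalMap f') (ξ η ξ' η' : H) :
    @Continuous _ _ (ultraweakTopology S) _
      (vectorFunctional f ξ η - vectorFunctional f' ξ' η' : Elt S →ₗ[ℂ] ℂ) :=
  @Continuous.comp _ _ _ (ultraweakTopology S) _ _
    (fun x => (vectorFunctional f ξ η x, vectorFunctional f' ξ' η' x)) (fun p : ℂ × ℂ => p.1 - p.2)
    continuous_sub
    (@Continuous.prodMk _ _ _ _ _ (ultraweakTopology S) _ _ (continuous_vectorFunctional hf ξ η)
      (continuous_vectorFunctional hf' ξ' η'))

/-- Every ultraweakly continuous functional is a linear combination of the functionals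
`x ↦ ∑ₙ ⟪ηₙ, x ξₙ⟫`. -/
theorem mem_span_sumFunctional {S : VonNeumannAlgebra H} {ψ : Elt S →ₗ[ℂ] ℂ}
    (hψ : @Continuous _ _ (ultraweakTopology S) _ ψ) :
    ψ ∈ Submodule.span ℂ (Set.range (sumFunctional S)) := by
  rw [LinearMap.mem_span_iff_continuous, ← ultraweakTopology_eq_iInf]
  exact hψ

variable {X : Type*} [MeasurableSpace X] {μ : Measure X} [IsProbabilityMeasure μ]
  [TopologicalSpace X] [CompactSpace X] [OpensMeasurableSpace X]

/-- Ultraweakly continuous functionals commute with strong integrals. -/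
theorem continuous_and_map_opIntegral {S : VonNeumannAlgebra H} {ψ : Elt S →ₗ[ℂ] ℂ}
    (hψ : @Continuous _ _ (ultraweakTopology S) _ ψ) {F : X → H →L[ℂ] H}
    (hF : ∀ ξ, Continuous fun s => F s ξ) (hFS : ∀ s, F s ∈ S.toStarSubalgebra)
    (hS : ∀ f, opIntegral μ F hF f ∈ S.toStarSubalgebra) :
    (Continuous fun s => ψ ⟨F s, hFS s⟩) ∧
      ∀ f, ψ ⟨opIntegral μ F hF f, hS f⟩ = ∫ s, f s * ψ ⟨F s, hFS s⟩ ∂μ := by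
  have hspan := mem_span_sumFunctional hψ
  clear hψ
  induction hspan using Submodule.span_induction with
  | mem ψ h =>
    obtain ⟨p, rfl⟩ := h
    obtain ⟨C, hC⟩ := exists_norm_le_of_strongly_continuous hF
    have hc : ∀ n, Continuous fun s => ⟪p.1.2 n, F s (p.1.1 n)⟫_ℂ := fun n =>
      continuous_const.inner (hF _)
    have hb : ∀ n s, ‖⟪p.1.2 n, F s (p.1.1 n)⟫_ℂ‖ ≤ C * (‖p.1.1 n‖ ^ 2 + ‖p.1.2 n‖ ^ 2) :=
      fun n s => (norm_inner_apply_le _ _ _).trans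
        (mul_le_mul_of_nonneg_right (hC s) (by positivity))
    have hsum := p.summable_add.mul_left C
    refine ⟨continuous_tsum hc hsum hb, fun f => ?_⟩
    refine Eq.trans ?_ (hasSum_integral_mul_of_summable hc hsum hb f).tsum_eq
    exact tsum_congr fun n => inner_opIntegral hF f _ _
  | zero => exact ⟨continuous_const, fun f => by simp⟩
  | add ψ φ _ _ h1 h2 =>
    refine ⟨h1.1.add h2.1, fun f => ?_⟩
    simp only [LinearMap.add_apply, mul_add]
    rw [h1.2, h2.2]
    exact (integral_add (integrable_smul_of_continuous f h1.1)
      (integrable_smul_of_continuous f h2.1)).symm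
  | smul c ψ _ h =>
    refine ⟨h.1.const_smul c, fun f => ?_⟩
    simp only [LinearMap.smul_apply, smul_eq_mul, mul_left_comm _ c]
    rw [h.2, integral_const_mul]

end Ultraweak

section Density

variable {G : Type*} [Group G] [TopologicalSpace G] [IsTopologicalGroup G] [CompactSpace G]
  [T2Space G] [MeasurableSpace G] [BorelSpace G]
  (μ : Measure G) [μ.IsHaarMeasure] [IsProbabilityMeasure μ]

/-- The operators `λ(s)` span an ultraweakly dense subspace of `VN(G)`. The point is that
`xλ(h) = λ(xh)` for `x ∈ VN(G)`, so that a functional vanishing on the `λ(s)`, hence on the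
operators `λ(k)` with `k ∈ L²(G)`, vanishes at `xλ(h)` for all continuous `h`, hence at `x`. -/
theorem eq_zero_of_leftRegVN_eq_zero {ψ : Elt (groupVN μ) →ₗ[ℂ] ℂ}
    (hψ : @Continuous _ _ (ultraweakTopology (groupVN μ)) _ ψ)
    (h0 : ∀ s, ψ (leftRegVN μ s) = 0) (x : Elt (groupVN μ)) : ψ x = 0 := by
  have h1 : ∀ k, ψ ⟨leftConv μ k, leftConv_mem_groupVN μ k⟩ = 0 := fun k => by
    have h := (continuous_and_map_opIntegral (μ := μ) hψ (continuous_leftReg μ)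
      (leftReg_mem_groupVN μ) (leftConv_mem_groupVN μ)).2 k
    refine h.trans ?_
    have : ∀ s, ψ ⟨leftReg μ s, leftReg_mem_groupVN μ s⟩ = 0 := h0
    simp [this]
  have hx := (mem_groupVN_iff_commute_rightReg μ).1 x.2
  have hc : ∀ ξ, Continuous fun s => ((x : Lp ℂ 2 μ →L[ℂ] Lp ℂ 2 μ) * leftReg μ s) ξ :=
    fun ξ => (x : Lp ℂ 2 μ →L[ℂ] Lp ℂ 2 μ).continuous.comp (continuous_leftReg μ ξ)
  have hint : ∀ f, opIntegral μ (fun s => (x : Lp ℂ 2 μ →L[ℂ] Lp ℂ 2 μ) * leftReg μ s) hc f =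
      leftConv μ ((x : Lp ℂ 2 μ →L[ℂ] Lp ℂ 2 μ) f) := fun f => by
    rw [← mul_leftConv_of_commute μ hx]
    ext1 ξ
    exact (map_opIntegral_apply (continuous_leftReg μ) (x : Lp ℂ 2 μ →L[ℂ] Lp ℂ 2 μ) f ξ).symm
  obtain ⟨h2, h3⟩ := continuous_and_map_opIntegral (μ := μ) hψ hc
    (fun s => mul_mem x.2 (leftReg_mem_groupVN μ s))
    (fun f => by rw [hint]; exact leftConv_mem_groupVN μ _)
  have h4 := eq_zero_of_integral_mul_eq_zero μ h2 (fun h => by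
    rw [← h3]
    simp only [hint]
    exact h1 _) 1
  simpa [leftReg_one] using h4

end Density

/-! ### Hilbert-Schmidt operators and the usual trace -/

section Trace

variable {H : Type*} [NormedAddCommGroup H] [InnerProductSpace ℂ H] [CompleteSpace H]

variable (H) in
/-- The index type of the orthonormal basis used in `operatorTrace`. -/
abbrev BasisIndex : Type _ := ↥(exists_hilbertBasis ℂ H).choose

variable (H) in
/-- The orthonormal basis used in `operatorTrace`. -/
noncomputable def traceBasis : HilbertBasis (BasisIndex H) ℂ H :=
  (exists_hilbertBasis ℂ H).choose_spec.choose

/-- The trace of a positive operator, as an element of `[0,∞]`; for other operators the sum of the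
positive real parts of the diagonal, a junk value. -/
noncomputable def posTrace (x : H →L[ℂ] H) : ℝ≥0∞ :=
  ∑' i, ENNReal.ofReal (RCLike.re ⟪traceBasis H i, x (traceBasis H i)⟫_ℂ)

/-- The series defining the trace of `x` converges to `c`. -/
def HasOpTrace (x : H →L[ℂ] H) (c : ℂ) : Prop :=
  HasSum (fun i => ⟪traceBasis H i, x (traceBasis H i)⟫_ℂ) c

theorem HasOpTrace.add {x y : H →L[ℂ] H} {c d : ℂ} (hx : HasOpTrace x c) (hy : HasOpTrace y d) :
    HasOpTrace (x + y) (c + d) :=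
  (HasSum.add hx hy).congr_fun fun i => by rw [add_apply, inner_add_right]

theorem HasOpTrace.sub {x y : H →L[ℂ] H} {c d : ℂ} (hx : HasOpTrace x c) (hy : HasOpTrace y d) :
    HasOpTrace (x - y) (c - d) :=
  (HasSum.sub hx hy).congr_fun fun i => by rw [sub_apply, inner_sub_right]

theorem HasOpTrace.smul {x : H →L[ℂ] H} {c : ℂ} (hx : HasOpTrace x c) (k : ℂ) :
    HasOpTrace (k • x) (k * c) :=
  (HasSum.mul_left k hx).congr_fun fun i => by rw [smul_apply, inner_smul_right]

theorem HasOpTrace.unique {x : H →L[ℂ] H} {c d : ℂ} (hx : HasOpTrace x c)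
    (hy : HasOpTrace x d) : c = d := HasSum.unique hx hy

theorem HasOpTrace.congr {x y : H →L[ℂ] H} {c : ℂ} (hx : HasOpTrace x c) (h : x = y) :
    HasOpTrace y c := h ▸ hx

/-- The trace of an operator, a junk value unless the diagonal is summable. -/
noncomputable def opTrace (x : H →L[ℂ] H) : ℂ :=
  ∑' i, ⟪traceBasis H i, x (traceBasis H i)⟫_ℂ

/-- Hilbert-Schmidt operators: `∑ᵢ ‖a eᵢ‖² < ∞`. -/
def IsHilbertSchmidt (a : H →L[ℂ] H) : Prop := Summable fun i => ‖a (traceBasis H i)‖ ^ 2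

theorem inner_star_mul_apply (a b : H →L[ℂ] H) (ξ η : H) :
    ⟪ξ, (star a * b) η⟫_ℂ = ⟪a ξ, b η⟫_ℂ := by
  rw [mul_apply_eq_comp, ContinuousLinearMap.star_eq_adjoint,
    ContinuousLinearMap.adjoint_inner_right]

theorem posTrace_star_mul_self (a : H →L[ℂ] H) :
    posTrace (star a * a) = ∑' i, ENNReal.ofReal (‖a (traceBasis H i)‖ ^ 2) := by
  simp only [posTrace, inner_star_mul_apply, inner_self_eq_norm_sq]

theorem hasSum_norm_inner_sq {ι : Type*} (e : HilbertBasis ι ℂ H) (ξ : H) :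
    HasSum (fun i => ‖⟪ξ, e i⟫_ℂ‖ ^ 2) (‖ξ‖ ^ 2) := by
  have h := (e.hasSum_inner_mul_inner ξ ξ).mapL Complex.reCLM
  simp only [Complex.reCLM_apply] at h
  have h2 : (⟪ξ, ξ⟫_ℂ).re = ‖ξ‖ ^ 2 := inner_self_eq_norm_sq (𝕜 := ℂ) ξ
  rw [h2] at h
  refine h.congr_fun fun i => ?_
  rw [← inner_conj_symm (e i) ξ, Complex.mul_conj', ← Complex.ofReal_pow, Complex.ofReal_re]

theorem posTrace_star_mul_self_comm (a : H →L[ℂ] H) :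
    posTrace (star a * a) = posTrace (a * star a) := by
  have h : ∀ b : H →L[ℂ] H, posTrace (star b * b) =
      ∑' i, ∑' j, ENNReal.ofReal (‖⟪b (traceBasis H i), traceBasis H j⟫_ℂ‖ ^ 2) := fun b => by
    rw [posTrace_star_mul_self]
    refine tsum_congr fun i => ?_
    have h1 := hasSum_norm_inner_sq (traceBasis H) (b (traceBasis H i))
    rw [← h1.tsum_eq, ENNReal.ofReal_tsum_of_nonneg (fun _ => by positivity) h1.summable]
  have h2 := h (star a)
  rw [star_star] at h2
  rw [h, h2, ENNReal.tsum_comm]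
  refine tsum_congr fun i => tsum_congr fun j => ?_
  rw [ContinuousLinearMap.star_eq_adjoint, ContinuousLinearMap.adjoint_inner_left,
    norm_inner_symm]

theorem isHilbertSchmidt_iff {a : H →L[ℂ] H} :
    IsHilbertSchmidt a ↔ posTrace (star a * a) < ∞ := by
  rw [posTrace_star_mul_self, IsHilbertSchmidt]
  constructor
  · intro h
    rw [← ENNReal.ofReal_tsum_of_nonneg (fun _ => by positivity) h]
    exact ENNReal.ofReal_lt_top
  · intro h
    refine (ENNReal.summable_toReal h.ne).congr fun i => ?_
    rw [ENNReal.toReal_ofReal (by positivity)]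

protected theorem IsHilbertSchmidt.star {a : H →L[ℂ] H} (ha : IsHilbertSchmidt a) :
    IsHilbertSchmidt (star a) := by
  rw [isHilbertSchmidt_iff] at ha ⊢
  rwa [star_star, ← posTrace_star_mul_self_comm]

theorem IsHilbertSchmidt.add {a b : H →L[ℂ] H} (ha : IsHilbertSchmidt a)
    (hb : IsHilbertSchmidt b) : IsHilbertSchmidt (a + b) := by
  refine Summable.of_nonneg_of_le (fun _ => by positivity) (fun i => ?_)
    ((Summable.add ha hb).mul_left 2)
  have h1 := norm_add_le (a (traceBasis H i)) (b (traceBasis H i))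
  have h2 := sq_nonneg (‖a (traceBasis H i)‖ - ‖b (traceBasis H i)‖)
  rw [add_apply]
  nlinarith [norm_nonneg (a (traceBasis H i) + b (traceBasis H i))]

theorem IsHilbertSchmidt.mul_left {a : H →L[ℂ] H} (ha : IsHilbertSchmidt a) (b : H →L[ℂ] H) :
    IsHilbertSchmidt (b * a) := by
  refine Summable.of_nonneg_of_le (fun _ => by positivity) (fun i => ?_)
    (Summable.mul_left (‖b‖ ^ 2) ha)
  rw [← mul_pow]
  exact pow_le_pow_left₀ (norm_nonneg _) (b.le_opNorm _) 2

theorem IsHilbertSchmidt.mul_right {a : H →L[ℂ] H} (ha : IsHilbertSchmidt a) (b : H →L[ℂ] H) :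
    IsHilbertSchmidt (a * b) := by
  have := (ha.star.mul_left (star b)).star
  rwa [star_mul, star_star, star_star] at this

theorem IsHilbertSchmidt.smul {a : H →L[ℂ] H} (ha : IsHilbertSchmidt a) (c : ℂ) :
    IsHilbertSchmidt (c • a) := by
  have := ha.mul_left (c • 1)
  rwa [smul_mul_assoc, one_mul] at this

theorem IsHilbertSchmidt.sub {a b : H →L[ℂ] H} (ha : IsHilbertSchmidt a)
    (hb : IsHilbertSchmidt b) : IsHilbertSchmidt (a - b) := by
  have := ha.add (hb.smul (-1))
  rwa [neg_one_smul, ← sub_eq_add_neg] at this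

theorem hasSum_posTrace {x : H →L[ℂ] H} (hx : 0 ≤ x) (hfin : posTrace x < ∞) :
    HasOpTrace x ((posTrace x).toReal : ℂ) := by
  have hpos := (ContinuousLinearMap.nonneg_iff_isPositive x).1 hx
  have h0 : ∀ ξ, 0 ≤ RCLike.re ⟪ξ, x ξ⟫_ℂ := hpos.re_inner_nonneg_right
  have h1 : HasSum (fun i => RCLike.re ⟪traceBasis H i, x (traceBasis H i)⟫_ℂ)
      (posTrace x).toReal := by
    have h2 := ENNReal.hasSum_toReal hfin.ne
    rw [← ENNReal.tsum_toReal_eq fun _ => ENNReal.ofReal_ne_top] at h2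
    refine h2.congr_fun fun i => ?_
    rw [ENNReal.toReal_ofReal (h0 _)]
  refine (h1.mapL Complex.ofRealCLM).congr_fun fun i => ?_
  have h3 := hpos.inner_nonneg_right (traceBasis H i)
  exact (RCLike.conj_eq_iff_re.1 (RCLike.nonneg_iff.1 h3 |>.2 |> RCLike.conj_eq_iff_im.2)).symm

theorem IsHilbertSchmidt.hasSum_star_mul {a b : H →L[ℂ] H} (ha : IsHilbertSchmidt a)
    (hb : IsHilbertSchmidt b) :
    HasOpTrace (star a * b) (opTrace (star a * b)) := by
  refine (Summable.of_norm_bounded (Summable.add ha hb) fun i => ?_).hasSum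
  rw [inner_star_mul_apply]
  refine (norm_inner_le_norm _ _).trans ?_
  nlinarith [sq_nonneg (‖a (traceBasis H i)‖ - ‖b (traceBasis H i)‖),
    sq_nonneg ‖a (traceBasis H i)‖, sq_nonneg ‖b (traceBasis H i)‖]

theorem IsHilbertSchmidt.hasSum_mul {a b : H →L[ℂ] H} (ha : IsHilbertSchmidt a)
    (hb : IsHilbertSchmidt b) :
    HasOpTrace (a * b) (opTrace (a * b)) := by
  have := ha.star.hasSum_star_mul hb
  rwa [star_star] at this

theorem IsHilbertSchmidt.opTrace_star_mul_self {a : H →L[ℂ] H} (ha : IsHilbertSchmidt a) :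
    opTrace (star a * a) = ((posTrace (star a * a)).toReal : ℂ) :=
  (hasSum_posTrace (star_mul_self_nonneg a) (isHilbertSchmidt_iff.1 ha)).tsum_eq

theorem IsHilbertSchmidt.opTrace_star_mul_self_comm {a : H →L[ℂ] H} (ha : IsHilbertSchmidt a) :
    opTrace (star a * a) = opTrace (a * star a) := by
  have := ha.star.opTrace_star_mul_self
  rw [star_star] at this
  rw [this, ha.opTrace_star_mul_self, posTrace_star_mul_self_comm]

/-- Polarization; the coefficients are written so that the four terms fit `HasTrace`. -/
theorem polarization_mul (a b a' b' : H →L[ℂ] H) :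
    a' * b = ((1 / 4 : ℝ) : ℂ) • ((a' + b') * (a + b)) -
        ((1 / 4 : ℝ) : ℂ) • ((a' - b') * (a - b)) +
      Complex.I • (((1 / 4 : ℝ) : ℂ) • ((a' + Complex.I • b') * (a - Complex.I • b)) -
        ((1 / 4 : ℝ) : ℂ) • ((a' - Complex.I • b') * (a + Complex.I • b))) := by
  simp only [add_mul, sub_mul, mul_add, mul_sub, smul_mul_assoc, mul_smul_comm, smul_sub,
    smul_add, smul_smul]
  match_scalars <;> ring_nf <;> simp only [Complex.I_sq] <;> ring_nf

/-- The trace property for products of Hilbert-Schmidt operators. -/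
theorem IsHilbertSchmidt.opTrace_mul_comm {a b : H →L[ℂ] H} (ha : IsHilbertSchmidt a)
    (hb : IsHilbertSchmidt b) : opTrace (a * b) = opTrace (b * a) := by
  have key : ∀ c : H →L[ℂ] H, IsHilbertSchmidt c → HasOpTrace (star c * c) (opTrace (star c * c)) ∧
      HasOpTrace (c * star c) (opTrace (star c * c)) := fun c hc =>
    ⟨hc.hasSum_star_mul hc, by rw [hc.opTrace_star_mul_self_comm]; exact hc.hasSum_mul hc.star⟩
  have ha' := ha.star
  obtain ⟨p1, q1⟩ := key _ (ha'.add hb)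
  obtain ⟨p2, q2⟩ := key _ (ha'.sub hb)
  obtain ⟨p3, q3⟩ := key _ (ha'.sub (hb.smul Complex.I))
  obtain ⟨p4, q4⟩ := key _ (ha'.add (hb.smul Complex.I))
  have hp := ((p1.smul ((1 / 4 : ℝ) : ℂ)).sub (p2.smul ((1 / 4 : ℝ) : ℂ))).add
    (((p3.smul ((1 / 4 : ℝ) : ℂ)).sub (p4.smul ((1 / 4 : ℝ) : ℂ))).smul Complex.I)
  have hq := ((q1.smul ((1 / 4 : ℝ) : ℂ)).sub (q2.smul ((1 / 4 : ℝ) : ℂ))).add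
    (((q3.smul ((1 / 4 : ℝ) : ℂ)).sub (q4.smul ((1 / 4 : ℝ) : ℂ))).smul Complex.I)
  have h1 := hp.congr (y := a * b)
    (by rw [polarization_mul (star a) b a (star b)]; simp [sub_eq_add_neg])
  have h2 := hq.congr (y := b * a) (by
    simp only [star_add, star_sub, star_smul, star_star, Complex.star_def, Complex.conj_I,
      add_mul, sub_mul, mul_add, mul_sub, smul_mul_assoc, mul_smul_comm, smul_sub,
      smul_add, smul_smul]
    match_scalars <;> ring_nf <;> simp only [Complex.I_sq] <;> ring_nf)
  exact ((ha.hasSum_mul hb).unique h1).trans (h2.unique (hb.hasSum_mul ha))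

/-! ### Traces on von Neumann algebras given by the usual trace -/

variable {S : VonNeumannAlgebra H} {τ : Elt S → ℝ≥0∞}

theorem nonneg_coe_iff {x : Elt S} : 0 ≤ x ↔ 0 ≤ (x : H →L[ℂ] H) := Iff.rfl

/-- The value of the linear extension of a restriction of the usual trace is computed by the
diagonal series. -/
theorem HasTrace.hasOpTrace (hτ : ∀ x, 0 ≤ x → τ x = posTrace (x : H →L[ℂ] H)) {z : Elt S} {c : ℂ}
    (h : HasTrace τ z c) : HasOpTrace (z : H →L[ℂ] H) c := by
  obtain ⟨p₁, p₂, p₃, p₄, h1, h2, h3, h4, rfl, rfl⟩ := h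
  have key : ∀ p : Elt S, (0 ≤ p ∧ τ p < ∞) →
      HasOpTrace (p : H →L[ℂ] H) ((τ p).toReal : ℂ) := fun p hp => by
    have h5 := hp.2
    rw [hτ p hp.1] at h5 ⊢
    exact hasSum_posTrace hp.1 h5
  exact ((key _ h1).sub (key _ h2)).add (((key _ h3).sub (key _ h4)).smul Complex.I)

/-- By polarization, products of two Hilbert-Schmidt elements belong to the span of the positive
elements of finite trace. -/
theorem exists_hasTrace_mul (hτ : ∀ x, 0 ≤ x → τ x = posTrace (x : H →L[ℂ] H)) {a b : Elt S}
    (ha : IsHilbertSchmidt (a : H →L[ℂ] H)) (hb : IsHilbertSchmidt (b : H →L[ℂ] H)) :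
    HasTrace τ (a * b) (opTrace ((a : H →L[ℂ] H) * (b : H →L[ℂ] H))) := by
  have key : ∀ c : Elt S, IsHilbertSchmidt (c : H →L[ℂ] H) →
      0 ≤ ((1 / 4 : ℝ) : ℂ) • (star c * c) ∧ τ (((1 / 4 : ℝ) : ℂ) • (star c * c)) < ∞ :=
    fun c hc => by
      have e : ((((1 / 4 : ℝ) : ℂ) • (star c * c) : Elt S) : H →L[ℂ] H) =
          star (((1 / 2 : ℝ) : ℂ) • (c : H →L[ℂ] H)) * (((1 / 2 : ℝ) : ℂ) • (c : H →L[ℂ] H)) := by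
        change ((1 / 4 : ℝ) : ℂ) • (star (c : H →L[ℂ] H) * (c : H →L[ℂ] H)) = _
        rw [star_smul, smul_mul_smul_comm, Complex.star_def, Complex.conj_ofReal,
          ← Complex.ofReal_mul]
        norm_num
      have h0 : 0 ≤ ((1 / 4 : ℝ) : ℂ) • (star c * c) := by
        rw [nonneg_coe_iff, e]
        exact star_mul_self_nonneg _
      refine ⟨h0, ?_⟩
      rw [hτ _ h0, e]
      exact isHilbertSchmidt_iff.1 (hc.smul _)
  have ha' : IsHilbertSchmidt ((star a : Elt S) : H →L[ℂ] H) := ha.star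
  have h : ∃ c, HasTrace τ (a * b) c := by
    refine ⟨_, _, _, _, _, key (star a + b) (ha'.add hb), key (star a - b) (ha'.sub hb),
      key (star a - Complex.I • b) (ha'.sub (hb.smul Complex.I)),
      key (star a + Complex.I • b) (ha'.add (hb.smul Complex.I)), ?_, rfl⟩
    refine Subtype.ext ((polarization_mul (star (a : H →L[ℂ] H)) b a (star (b : H →L[ℂ] H))).trans
      ?_)
    simp [sub_eq_add_neg]
  obtain ⟨c, hc⟩ := h
  rwa [(ha.hasSum_mul hb).unique (hc.hasOpTrace hτ)]

/-- Positive elements of a von Neumann algebra have a square root in it. -/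
theorem exists_sqrt {x : Elt S} (hx : 0 ≤ x) :
    ∃ v : Elt S, star (v : H →L[ℂ] H) = v ∧ (v : H →L[ℂ] H) * v = (x : H →L[ℂ] H) := by
  have hmem : CFC.sqrt (x : H →L[ℂ] H) ∈ S.toStarSubalgebra := by
    change CFC.sqrt (x : H →L[ℂ] H) ∈ S.carrier
    rw [← S.centralizer_centralizer', Set.mem_centralizer_iff]
    intro m hm
    exact (Commute.cfcₙ_nnreal ((Set.mem_centralizer_iff.1 hm) x x.2) NNReal.sqrt).eq.symm
  exact ⟨⟨_, hmem⟩, (IsSelfAdjoint.of_nonneg (CFC.sqrt_nonneg (x : H →L[ℂ] H))).star_eq,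
    CFC.sqrt_mul_sqrt_self (x : H →L[ℂ] H) hx⟩

theorem isHilbertSchmidt_of_mul_self {v x : H →L[ℂ] H} (hv : star v = v) (hx : v * v = x)
    (hfin : posTrace x < ∞) : IsHilbertSchmidt v := by
  rwa [isHilbertSchmidt_iff, hv, hx]

/-- If `‖b‖ ≤ 1` and `v` is self-adjoint, then `v b b* v ≤ v²`. -/
theorem mul_mul_star_le_of_norm_le_one {v b : H →L[ℂ] H} (hv : star v = v) (hb : ‖b‖ ≤ 1) :
    v * b * star (v * b) ≤ v * v := by
  have hbb : b * star b ≤ 1 := by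
    rw [← CStarAlgebra.norm_le_one_iff_of_nonneg _ (mul_star_self_nonneg b),
      CStarRing.norm_self_mul_star]
    exact mul_le_one₀ hb (norm_nonneg _) hb
  have h1 := star_left_conjugate_le_conjugate hbb v
  rw [hv, mul_one] at h1
  rwa [star_mul, hv, ← mul_assoc, mul_assoc v b]

end Trace

/-! ### The Plancherel formula -/

section Dini

variable {X : Type*} [TopologicalSpace X] [CompactSpace X] [MeasurableSpace X]
  [OpensMeasurableSpace X] {μ : Measure X} [IsProbabilityMeasure μ]

/-- Term by term integration of an arbitrary (possibly uncountable) sum of nonnegative continuous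
functions whose sum is constant; the convergence is uniform by Dini's theorem. -/
theorem hasSum_integral_of_nonneg_of_hasSum_const {ι : Type*} {g : ι → X → ℝ}
    (hg : ∀ i, Continuous (g i)) (h0 : ∀ i s, 0 ≤ g i s) {c : ℝ}
    (hc : ∀ s, HasSum (fun i => g i s) c) : HasSum (fun i => ∫ s, g i s ∂μ) c := by
  classical
  have hu : TendstoUniformly (fun (A : Finset ι) s => ∑ i ∈ A, g i s) (fun _ => c)
      Filter.atTop := by
    refine Monotone.tendstoUniformly_of_forall_tendsto (fun A => by fun_prop) ?_
      continuous_const hc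
    exact fun A B hAB s => Finset.sum_le_sum_of_subset_of_nonneg hAB fun i _ _ => h0 i s
  have hint : ∀ i, Integrable (g i) μ := fun i => by
    obtain ⟨C, hC⟩ := (isCompact_range (hg i)).isBounded.exists_norm_le
    exact Integrable.of_bound (aestronglyMeasurable_of_continuous (hg i)) C
      (ae_of_all _ fun s => hC _ ⟨s, rfl⟩)
  rw [HasSum, SummationFilter.unconditional_filter, Metric.tendsto_nhds]
  intro ε hε
  filter_upwards [Metric.tendstoUniformly_iff.1 hu (ε / 2) (half_pos hε)] with A hA
  have hA' : ∑ i ∈ A, ∫ s, g i s ∂μ - c = ∫ s, (∑ i ∈ A, g i s - c) ∂μ := by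
    rw [integral_sub (integrable_finsetSum _ fun i _ => hint i) (integrable_const c),
      integral_finsetSum _ fun i _ => hint i, integral_const, probReal_univ, one_smul]
  rw [dist_eq_norm, hA']
  refine lt_of_le_of_lt (norm_integral_le_of_norm_le_const (C := ε / 2)
    (ae_of_all _ fun s => ?_)) ?_
  · rw [← dist_eq_norm, dist_comm]
    exact (hA s).le
  · rw [probReal_univ, mul_one]
    exact half_lt_self hε

end Dini

section Plancherel

theorem eq_zero_of_posTrace_eq_zero {H : Type*} [NormedAddCommGroup H] [InnerProductSpace ℂ H]
    [CompleteSpace H] {a : H →L[ℂ] H} (ha : posTrace (star a * a) = 0) : a = 0 := by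
  rw [posTrace_star_mul_self, ENNReal.tsum_eq_zero] at ha
  refine ContinuousLinearMap.ext_on
    (Submodule.dense_iff_topologicalClosure_eq_top.2 (traceBasis H).dense_span) ?_
  rintro _ ⟨i, rfl⟩
  have h := ha i
  rw [ENNReal.ofReal_eq_zero] at h
  have h1 : ‖a (traceBasis H i)‖ = 0 := by
    nlinarith [norm_nonneg (a (traceBasis H i))]
  simpa using h1

variable {G : Type*} [Group G] [TopologicalSpace G] [IsTopologicalGroup G] [CompactSpace G]
  [T2Space G] [MeasurableSpace G] [BorelSpace G]
  (μ : Measure G) [μ.IsHaarMeasure] [IsProbabilityMeasure μ]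

local notation "L²" => Lp ℂ 2 μ

theorem norm_toL2_sq (h : C(G, ℂ)) : ‖toL2 μ h‖ ^ 2 = ∫ s, ‖h s‖ ^ 2 ∂μ := by
  have h1 := ContinuousMap.inner_toLp (𝕜 := ℂ) μ h h
  rw [inner_self_eq_norm_sq_to_K] at h1
  have h2 : ∀ s, h s * (starRingEnd ℂ) (h s) = ((‖h s‖ ^ 2 : ℝ) : ℂ) := fun s => by
    rw [Complex.mul_conj', Complex.ofReal_pow]
  simp only [h2] at h1
  rw [integral_complex_ofReal] at h1
  exact Complex.ofReal_injective ((Complex.ofReal_pow _ _).trans h1)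

/-- The Plancherel formula for continuous functions: for each `s` the vectors
`conj h(s·⁻¹)` have norm `‖h‖`, and Parseval's identity gives the sum over the basis. -/
theorem hasSum_norm_leftConv_toL2_sq (h : C(G, ℂ)) :
    HasSum (fun i => ‖leftConv μ (toL2 μ h) (traceBasis L² i)‖ ^ 2) (‖toL2 μ h‖ ^ 2) := by
  choose k hk1 hk2 using fun i => exists_continuousMap_leftConv μ h (traceBasis L² i)
  let ψ : G → C(G, ℂ) := fun s => ⟨fun t => star (h (s * t⁻¹)), by fun_prop⟩
  have hkψ : ∀ i s, ‖k i s‖ ^ 2 = ‖⟪toL2 μ (ψ s), traceBasis L² i⟫_ℂ‖ ^ 2 := fun i s => by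
    rw [hk2, L2.inner_def]
    congr 2
    refine integral_congr_ae ?_
    filter_upwards [coeFn_toL2 μ (ψ s)] with t ht
    rw [ht]
    simp [ψ]
  have hnorm : ∀ s, ‖toL2 μ (ψ s)‖ ^ 2 = ‖toL2 μ h‖ ^ 2 := fun s => by
    rw [norm_toL2_sq, norm_toL2_sq]
    refine Eq.trans ?_ (integral_div_left_eq_self (fun t => ‖h t‖ ^ 2) μ s)
    simp [ψ, div_eq_mul_inv]
  have h1 := hasSum_integral_of_nonneg_of_hasSum_const (μ := μ) (g := fun i s => ‖k i s‖ ^ 2)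
    (c := ‖toL2 μ h‖ ^ 2) (fun i => by fun_prop) (fun i s => by positivity) (fun s => by
      simp only [hkψ]
      rw [← hnorm s]
      exact hasSum_norm_inner_sq _ _)
  refine h1.congr_fun fun i => ?_
  rw [hk1, norm_toL2_sq]

theorem sum_norm_leftConv_sq_le (f : L²) (A : Finset (BasisIndex L²)) :
    ∑ i ∈ A, ‖leftConv μ f (traceBasis L² i)‖ ^ 2 ≤ ‖f‖ ^ 2 := by
  refine (denseRange_toL2 μ).induction_on
    (p := fun f => ∑ i ∈ A, ‖leftConv μ f (traceBasis L² i)‖ ^ 2 ≤ ‖f‖ ^ 2) f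
    (isClosed_le (by fun_prop) (by fun_prop)) fun h => ?_
  have := hasSum_norm_leftConv_toL2_sq μ h
  rw [← this.tsum_eq]
  exact this.summable.sum_le_tsum _ fun i _ => by positivity

theorem isHilbertSchmidt_leftConv (f : L²) : IsHilbertSchmidt (leftConv μ f) :=
  summable_of_sum_le (fun _ => by positivity) (sum_norm_leftConv_sq_le μ f)

/-- The Plancherel formula `tr(λ(f)* λ(f)) = ‖f‖²`. -/
theorem tsum_norm_leftConv_sq (f : L²) :
    ∑' i, ‖leftConv μ f (traceBasis L² i)‖ ^ 2 = ‖f‖ ^ 2 := by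
  set q : L² → ℝ := fun f => ∑' i, ‖leftConv μ f (traceBasis L² i)‖ ^ 2 with hq
  have hle : ∀ f, q f ≤ ‖f‖ ^ 2 := fun f =>
    (isHilbertSchmidt_leftConv μ f).tsum_le_of_sum_le (sum_norm_leftConv_sq_le μ f)
  have hpar : ∀ a b, q (a + b) + q (a - b) = 2 * (q a + q b) := fun a b => by
    have ha := isHilbertSchmidt_leftConv μ a
    have hb := isHilbertSchmidt_leftConv μ b
    rw [hq]
    dsimp only
    rw [← Summable.tsum_add (isHilbertSchmidt_leftConv μ (a + b))
      (isHilbertSchmidt_leftConv μ (a - b)), ← Summable.tsum_add ha hb, ← tsum_mul_left]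
    refine tsum_congr fun i => ?_
    have := parallelogram_law_with_norm ℂ (leftConv μ a (traceBasis L² i))
      (leftConv μ b (traceBasis L² i))
    simp only [map_add, map_sub, add_apply, sub_apply]
    nlinarith
  refine le_antisymm (hle f) (sub_nonpos.1 ?_)
  -- `‖f‖² - q(f)` is a nonnegative quadratic form which vanishes on continuous functions
  have key : ∀ g, ‖f‖ ^ 2 - q f ≤ 2 * ‖f - g‖ ^ 2 := fun g => by
    refine (denseRange_toL2 μ).induction_on
      (p := fun g => ‖f‖ ^ 2 - q f ≤ 2 * ‖f - g‖ ^ 2) g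
      (isClosed_le (by fun_prop) (by fun_prop)) fun h => ?_
    set g := toL2 μ h
    have h1 := hpar (f - g) g
    have h2 := parallelogram_law_with_norm ℂ (f - g) g
    have h3 : q g = ‖g‖ ^ 2 := (hasSum_norm_leftConv_toL2_sq μ h).tsum_eq
    have h4 := hle (f - g - g)
    have h5 : 0 ≤ q (f - g) := tsum_nonneg fun _ => by positivity
    rw [sub_add_cancel] at h1 h2
    nlinarith
  simpa using key f

theorem posTrace_star_leftConv_mul_self (f : L²) :
    posTrace (star (leftConv μ f) * leftConv μ f) = ENNReal.ofReal (‖f‖ ^ 2) := by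
  rw [posTrace_star_mul_self, ← tsum_norm_leftConv_sq,
    ENNReal.ofReal_tsum_of_nonneg (fun _ => by positivity) (isHilbertSchmidt_leftConv μ f)]

theorem opTrace_star_leftConv_mul (f h : L²) :
    opTrace (star (leftConv μ f) * leftConv μ h) = ⟪f, h⟫_ℂ := by
  have key : ∀ f : L², HasOpTrace (star (leftConv μ f) * leftConv μ f) ((‖f‖ : ℂ) ^ 2) :=
    fun f => by
      have h1 := (isHilbertSchmidt_leftConv μ f).opTrace_star_mul_self
      rw [posTrace_star_leftConv_mul_self, ENNReal.toReal_ofReal (by positivity),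
        Complex.ofReal_pow] at h1
      rw [← h1]
      exact (isHilbertSchmidt_leftConv μ f).hasSum_star_mul (isHilbertSchmidt_leftConv μ f)
  have h1 := ((((key (f + h)).smul ((1 / 4 : ℝ) : ℂ)).sub
      ((key (f - h)).smul ((1 / 4 : ℝ) : ℂ))).add
    ((((key (f - Complex.I • h)).smul ((1 / 4 : ℝ) : ℂ)).sub
      ((key (f + Complex.I • h)).smul ((1 / 4 : ℝ) : ℂ))).smul Complex.I)).congr
    (y := star (leftConv μ f) * leftConv μ h) (by
      refine Eq.trans ?_ (polarization_mul (leftConv μ f) _ _ (star (leftConv μ h))).symm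
      simp [sub_eq_add_neg])
  rw [((isHilbertSchmidt_leftConv μ f).hasSum_star_mul
    (isHilbertSchmidt_leftConv μ h)).unique h1, inner_eq_sum_norm_sq_div_four]
  simp only [RCLike.I_to_complex, Complex.coe_algebraMap]
  push_cast
  ring

theorem norm_opTrace_star_mul_le {a b : L² →L[ℂ] L²} (ha : IsHilbertSchmidt a)
    (hb : IsHilbertSchmidt b) : ‖opTrace (star a * b)‖ ≤
      ∑' i, ‖a (traceBasis L² i)‖ ^ 2 + ∑' i, ‖b (traceBasis L² i)‖ ^ 2 := by
  rw [← Summable.tsum_add ha hb]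
  refine tsum_of_norm_bounded (Summable.add ha hb).hasSum fun i => ?_
  rw [inner_star_mul_apply]
  refine (norm_inner_le_norm _ _).trans ?_
  nlinarith [sq_nonneg (‖a (traceBasis L² i)‖ - ‖b (traceBasis L² i)‖),
    sq_nonneg ‖a (traceBasis L² i)‖, sq_nonneg ‖b (traceBasis L² i)‖]

/-- A Hilbert-Schmidt operator in `VN(G)` is a convolution operator. The Riesz representation
theorem provides `f` such that `z = y - λ(f)` is orthogonal to all `λ(k)`; then
`‖zλ(h)‖² = tr(z* λ(zh) λ(h)*) = 0` for continuous `h`, since `λ(zh) λ(h)*` is again of the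
form `λ(k)`. -/
theorem exists_eq_leftConv {y : L² →L[ℂ] L²} (hy : ∀ s, y * rightReg μ s = rightReg μ s * y)
    (hHS : IsHilbertSchmidt y) : ∃ f, y = leftConv μ f := by
  have hs := fun h => hHS.hasSum_star_mul (isHilbertSchmidt_leftConv μ h)
  let l : L² →ₗ[ℂ] ℂ :=
    { toFun := fun h => opTrace (star y * leftConv μ h)
      map_add' := fun h k => ((hs (h + k)).unique (((hs h).add (hs k)).congr
        (by rw [map_add, mul_add])))
      map_smul' := fun c h => (hs (c • h)).unique (((hs h).smul c).congr
        (by rw [map_smul, mul_smul_comm])) }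
  have hl : ∀ h, ‖l h‖ ≤ (∑' i, ‖y (traceBasis L² i)‖ ^ 2 + 1) / 1 * ‖h‖ := fun h =>
    LinearMap.bound_of_sphere_bound one_pos _ l (fun z hz => by
      refine (norm_opTrace_star_mul_le μ hHS (isHilbertSchmidt_leftConv μ z)).trans ?_
      rw [tsum_norm_leftConv_sq, mem_sphere_zero_iff_norm.1 hz, one_pow]) h
  let f := (InnerProductSpace.toDual ℂ L²).symm (l.mkContinuous _ hl)
  have hf : ∀ h, ⟪f, h⟫_ℂ = opTrace (star y * leftConv μ h) := fun h =>
    InnerProductSpace.toDual_symm_apply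
  refine ⟨f, sub_eq_zero.1 (eq_zero_of_mul_leftConv_eq_zero μ fun h => ?_)⟩
  set z := y - leftConv μ f with hz
  have hcomm : ∀ k s, leftConv μ k * rightReg μ s = rightReg μ s * leftConv μ k := fun k =>
    (mem_groupVN_iff_commute_rightReg μ).1 (leftConv_mem_groupVN μ k)
  have hzc : ∀ s, z * rightReg μ s = rightReg μ s * z := fun s => by
    rw [hz, sub_mul, mul_sub, hy, hcomm]
  have hzHS : IsHilbertSchmidt z := hHS.sub (isHilbertSchmidt_leftConv μ f)
  have horth : ∀ k, opTrace (star z * leftConv μ k) = 0 := fun k => by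
    have h1 := ((hs k).sub ((isHilbertSchmidt_leftConv μ f).hasSum_star_mul
      (isHilbertSchmidt_leftConv μ k))).congr (y := star z * leftConv μ k)
      (by rw [hz, star_sub, sub_mul])
    rw [opTrace_star_leftConv_mul, hf, sub_self] at h1
    exact (hzHS.hasSum_star_mul (isHilbertSchmidt_leftConv μ k)).unique h1
  obtain ⟨k, hk⟩ := star_leftConv μ h
  have hw : opTrace (star (z * leftConv μ (toL2 μ h)) * (z * leftConv μ (toL2 μ h))) = 0 := by
    have e1 : star (z * leftConv μ (toL2 μ h)) * (z * leftConv μ (toL2 μ h)) =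
        leftConv μ k * (star z * leftConv μ (z (toL2 μ h))) := by
      rw [star_mul, hk, mul_assoc, mul_leftConv_of_commute μ hzc]
    rw [e1, (isHilbertSchmidt_leftConv μ k).opTrace_mul_comm
      ((isHilbertSchmidt_leftConv μ _).mul_left _), mul_assoc,
      mul_leftConv_of_commute μ (hcomm _), horth]
  have hwHS : IsHilbertSchmidt (z * leftConv μ (toL2 μ h)) := hzHS.mul_right _
  rw [hwHS.opTrace_star_mul_self] at hw
  refine eq_zero_of_posTrace_eq_zero ?_
  have := (ENNReal.toReal_eq_zero_iff _).1 (by exact_mod_cast hw)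
  exact this.resolve_right (isHilbertSchmidt_iff.1 hwHS).ne

/-- The Plancherel trace is the restriction of the usual trace. -/
theorem plancherelTrace_eq_posTrace (x : Elt (groupVN μ)) (hx : 0 ≤ x) :
    plancherelTrace μ x = posTrace (x : L² →L[ℂ] L²) := by
  refine le_antisymm ?_ ?_
  · by_cases hfin : posTrace (x : L² →L[ℂ] L²) < ∞
    · obtain ⟨v, hv, hvx⟩ := exists_sqrt hx
      obtain ⟨f, hf⟩ := exists_eq_leftConv μ ((mem_groupVN_iff_commute_rightReg μ).1 v.2)
        (isHilbertSchmidt_of_mul_self hv hvx hfin)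
      have hxf : (x : L² →L[ℂ] L²) = star (leftConv μ f) * leftConv μ f := by
        rw [← hf, hv, hvx]
      refine (iInf₂_le f ⟨leftConv μ f, (isLeftConvolution_iff μ).2 rfl, hxf⟩).trans ?_
      rw [hxf, posTrace_star_leftConv_mul_self]
    · rw [not_lt_top_iff.1 hfin]
      exact le_top
  · refine le_iInf₂ fun f hf => ?_
    obtain ⟨y, hy, hxy⟩ := hf
    rw [hxy, (isLeftConvolution_iff μ).1 hy, posTrace_star_leftConv_mul_self]

end Plancherel

/-! ### Suprema of directed families of operators -/

section Directed

variable {H : Type*} [NormedAddCommGroup H] [InnerProductSpace ℂ H] [CompleteSpace H]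

open scoped ComplexOrder in
theorem nonneg_iff_inner {T : H →L[ℂ] H} : 0 ≤ T ↔ ∀ v, 0 ≤ ⟪T v, v⟫_ℂ := by
  rw [ContinuousLinearMap.nonneg_iff_isPositive, ContinuousLinearMap.isPositive_iff_complex]
  refine forall_congr' fun v => ?_
  rw [Complex.nonneg_iff, Complex.ext_iff]
  simp only [RCLike.re_to_complex, Complex.ofReal_re, Complex.ofReal_im, true_and]
  exact and_comm

open scoped ComplexOrder in
theorem le_iff_inner {S T : H →L[ℂ] H} : S ≤ T ↔ ∀ v, ⟪S v, v⟫_ℂ ≤ ⟪T v, v⟫_ℂ := by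
  rw [← sub_nonneg, nonneg_iff_inner]
  simp

open Filter Topology in
open scoped ComplexOrder in
/-- A bounded directed family of positive operators has a supremum, namely its weak limit; hence
the supremum commutes with every operator that commutes with all members of the family. -/
theorem exists_isLUB_of_directedOn {D : Set (H →L[ℂ] H)} (hne : D.Nonempty)
    (h0 : ∀ d ∈ D, 0 ≤ d) (hdir : DirectedOn (· ≤ ·) D) {b : H →L[ℂ] H}
    (hb : b ∈ upperBounds D) :
    ∃ y, IsLUB D y ∧ ∀ c, (∀ d ∈ D, c * d = d * c) → c * y = y * c := by
  have : Nonempty D := hne.to_subtype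
  have : IsDirectedOrder D := ⟨fun x y => by
    obtain ⟨z, hz, hxz, hyz⟩ := hdir x x.2 y y.2
    exact ⟨⟨z, hz⟩, hxz, hyz⟩⟩
  have hdiag : ∀ v, ∃ c, Tendsto (fun d : D => ⟪(d : H →L[ℂ] H) v, v⟫_ℂ) atTop (𝓝 c) := fun v => by
    have hmono : Monotone fun d : D => (⟪(d : H →L[ℂ] H) v, v⟫_ℂ).re := fun d e hde =>
      (Complex.le_def.1 (le_iff_inner.1 (show (d : H →L[ℂ] H) ≤ e from hde) v)).1
    have hbdd : BddAbove (Set.range fun d : D => (⟪(d : H →L[ℂ] H) v, v⟫_ℂ).re) := by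
      refine ⟨(⟪b v, v⟫_ℂ).re, ?_⟩
      rintro _ ⟨d, rfl⟩
      exact (Complex.le_def.1 (le_iff_inner.1 (hb d.2) v)).1
    refine ⟨_, ((Complex.continuous_ofReal.tendsto _).comp
      (tendsto_atTop_ciSup hmono hbdd)).congr fun d => ?_⟩
    exact Complex.ext rfl (Complex.nonneg_iff.1 (nonneg_iff_inner.1 (h0 d d.2) v)).2
  have hex : ∀ v w, ∃ c, Tendsto (fun d : D => ⟪(d : H →L[ℂ] H) v, w⟫_ℂ) atTop (𝓝 c) :=
    fun v w => by
      obtain ⟨c1, h1⟩ := hdiag (v + w)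
      obtain ⟨c2, h2⟩ := hdiag (v - w)
      obtain ⟨c3, h3⟩ := hdiag (v + Complex.I • w)
      obtain ⟨c4, h4⟩ := hdiag (v - Complex.I • w)
      refine ⟨_, ((((h1.sub h2).sub (h3.const_mul Complex.I)).add
        (h4.const_mul Complex.I)).div_const 4).congr fun d => ?_⟩
      exact (inner_map_polarization' ((d : H →L[ℂ] H) : H →ₗ[ℂ] H) v w).symm
  choose B hB using hex
  have hBle : ∀ v w, ‖B v w‖ ≤ ‖b‖ * ‖v‖ * ‖w‖ := fun v w =>
    le_of_tendsto (hB v w).norm (Eventually.of_forall fun d => by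
      refine (norm_inner_le_norm _ _).trans (mul_le_mul_of_nonneg_right ?_ (norm_nonneg _))
      exact ((d : H →L[ℂ] H).le_opNorm v).trans (mul_le_mul_of_nonneg_right
        (CStarAlgebra.norm_le_norm_of_nonneg_of_le (h0 d d.2) (hb d.2)) (norm_nonneg _)))
  let form : H →L⋆[ℂ] H →L[ℂ] ℂ := LinearMap.mkContinuous₂
    (LinearMap.mk₂'ₛₗ (starRingEnd ℂ) (RingHom.id ℂ) B
      (fun v v' w => tendsto_nhds_unique (hB _ _) (((hB v w).add (hB v' w)).congr fun d => by
        rw [map_add, inner_add_left]))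
      (fun c v w => tendsto_nhds_unique (hB _ _) (((hB v w).const_mul _).congr fun d => by
        rw [map_smul, inner_smul_left]))
      (fun v w w' => tendsto_nhds_unique (hB _ _) (((hB v w).add (hB v w')).congr fun d => by
        rw [inner_add_right]))
      (fun c v w => tendsto_nhds_unique (hB _ _) (((hB v w).const_mul _).congr fun d => by
        rw [inner_smul_right]; rfl))) ‖b‖ hBle
  let y : H →L[ℂ] H := InnerProductSpace.continuousLinearMapOfBilin form
  have hy : ∀ v w, Tendsto (fun d : D => ⟪(d : H →L[ℂ] H) v, w⟫_ℂ) atTop (𝓝 ⟪y v, w⟫_ℂ) :=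
    fun v w => by
      rw [InnerProductSpace.continuousLinearMapOfBilin_apply]
      exact hB v w
  refine ⟨y, ⟨fun d hd => le_iff_inner.2 fun v => ?_, fun c hc => le_iff_inner.2 fun v => ?_⟩,
    fun c hc => ?_⟩
  · refine ge_of_tendsto (hy v v) ?_
    filter_upwards [eventually_ge_atTop (⟨d, hd⟩ : D)] with e he
    exact le_iff_inner.1 (show d ≤ (e : H →L[ℂ] H) from he) v
  · exact le_of_tendsto (hy v v) (Eventually.of_forall fun d => le_iff_inner.1 (hc d.2) v)
  · ext1 v
    refine ext_inner_right ℂ fun w => ?_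
    have h1 : ⟪c (y v), w⟫_ℂ = ⟪y v, star c w⟫_ℂ := by
      rw [ContinuousLinearMap.star_eq_adjoint, ContinuousLinearMap.adjoint_inner_right]
    rw [mul_apply_eq_comp, mul_apply_eq_comp, h1]
    refine tendsto_nhds_unique (hy v _) ((hy (c v) w).congr fun d => ?_)
    have h2 := DFunLike.congr_fun (hc d d.2) v
    rw [mul_apply_eq_comp, mul_apply_eq_comp] at h2
    rw [← h2, ContinuousLinearMap.star_eq_adjoint, ContinuousLinearMap.adjoint_inner_right]

/-! ### Restriction to a von Neumann subalgebra -/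

theorem mem_fullAlgebra (x : H →L[ℂ] H) : x ∈ (fullAlgebra H).toStarSubalgebra :=
  trivial

/-- The inclusion of a von Neumann algebra `S ⊆ B(H)` into `B(H)`. -/
noncomputable def incl (S : VonNeumannAlgebra H) : Elt S →⋆ₐ[ℂ] Elt (fullAlgebra H) :=
  StarSubalgebra.inclusion (S₂ := (fullAlgebra H).toStarSubalgebra) fun _ _ => trivial

/-- The inclusion of `S ⊆ B(H)` into `B(H)` as a linear map. -/
noncomputable def inclLinear (S : VonNeumannAlgebra H) : Elt S →ₗ[ℂ] Elt (fullAlgebra H) where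
  toFun := incl S
  map_add' := map_add (incl S)
  map_smul' := map_smul (incl S)

theorem isNormalMap_incl (S : VonNeumannAlgebra H) : IsNormalMap (incl S) :=
  isNormalMap_iff.2 fun p => continuous_sumFunctional S p

theorem IsNormalMap.comp_inclLinear {K : Type*} [NormedAddCommGroup K] [InnerProductSpace ℂ K]
    [CompleteSpace K] {R : VonNeumannAlgebra K} {f : Elt (fullAlgebra H) →ₗ[ℂ] Elt R}
    (hf : IsNormalMap f) (S : VonNeumannAlgebra H) : IsNormalMap (f ∘ₗ inclLinear S) :=
  IsNormalMap.comp (g := f) (f := incl S) hf (isNormalMap_incl S)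

theorem IsNormalMap.comp_incl {K : Type*} [NormedAddCommGroup K] [InnerProductSpace ℂ K]
    [CompleteSpace K] {R : VonNeumannAlgebra K} {J : Elt (fullAlgebra H) →⋆ₐ[ℂ] Elt R}
    (hJ : IsNormalMap J) (S : VonNeumannAlgebra H) : IsNormalMap (J.comp (incl S)) :=
  IsNormalMap.comp (g := J) (f := incl S) hJ (isNormalMap_incl S)

/-- A normal linear map on `B(H)` that sends `S ⊆ B(H)` into itself restricts to a normal
linear map on `S`. -/
theorem IsNormalMap.exists_restrict {T : Elt (fullAlgebra H) →ₗ[ℂ] Elt (fullAlgebra H)}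
    (hT : IsNormalMap T) {S : VonNeumannAlgebra H}
    (h : ∀ x, (T (incl S x) : H →L[ℂ] H) ∈ S.toStarSubalgebra) :
    ∃ M : Elt S →ₗ[ℂ] Elt S, IsNormalMap M ∧
      ∀ x, (M x : H →L[ℂ] H) = T (incl S x) := by
  refine ⟨{ toFun := fun x => ⟨T (incl S x), h x⟩,
            map_add' := fun x y => Subtype.ext ?_, map_smul' := fun c x => Subtype.ext ?_ },
    isNormalMap_iff.2 fun p => isNormalMap_iff.1 (hT.comp_inclLinear S) p, fun x => rfl⟩
  · exact congrArg (fun z : Elt (fullAlgebra H) => (z : H →L[ℂ] H))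
      (by rw [map_add, map_add] : T (incl S (x + y)) = T (incl S x) + T (incl S y))
  · exact congrArg (fun z : Elt (fullAlgebra H) => (z : H →L[ℂ] H))
      (by rw [map_smul, map_smul] : T (incl S (c • x)) = c • T (incl S x))

theorem incl_pow_apply {S : VonNeumannAlgebra H}
    {T : Elt (fullAlgebra H) →ₗ[ℂ] Elt (fullAlgebra H)} {M : Elt S →ₗ[ℂ] Elt S}
    (h : ∀ x, T (incl S x) = incl S (M x)) (k : ℕ) (x : Elt S) :
    (T ^ k) (incl S x) = incl S ((M ^ k) x) := by
  induction k generalizing x with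
  | zero => rfl
  | succ k ih => rw [pow_succ, pow_succ, Module.End.mul_apply, Module.End.mul_apply, h, ih]

/-- The restriction of the usual trace to a von Neumann algebra is a normal faithful trace, and
it is a normal semifinite faithful trace as soon as it is semifinite. -/
theorem isNSFTrace_of_eq_posTrace {S : VonNeumannAlgebra H} {τ : Elt S → ℝ≥0∞}
    (hτ : ∀ x, 0 ≤ x → τ x = posTrace (x : H →L[ℂ] H))
    (hfull : IsNSFTrace (fullAlgebra H) operatorTrace)
    (hsemi : ∀ x : Elt S, 0 ≤ x → x ≠ 0 → ∃ y : Elt S, 0 ≤ y ∧ y ≤ x ∧ y ≠ 0 ∧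
      posTrace (y : H →L[ℂ] H) < ∞) : IsNSFTrace S τ where
  add x y hx hy := by
    rw [hτ x hx, hτ y hy, hτ (x + y) (nonneg_coe_iff.2 (add_nonneg hx hy))]
    exact hfull.add (incl S x) (incl S y) hx hy
  smul c x hc hx := by
    have h0 : 0 ≤ (c : ℂ) • (x : H →L[ℂ] H) :=
      (ContinuousLinearMap.nonneg_iff_isPositive _).2
        (((ContinuousLinearMap.nonneg_iff_isPositive _).1 hx).smul_of_nonneg
          (Complex.zero_le_real.2 hc))
    rw [hτ x hx, hτ ((c : ℂ) • x) h0]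
    exact hfull.smul c (incl S x) hc hx
  tracial x := by
    rw [hτ (star x * x) (star_mul_self_nonneg (x : H →L[ℂ] H)),
      hτ (x * star x) (mul_star_self_nonneg (x : H →L[ℂ] H))]
    exact posTrace_star_mul_self_comm _
  normal D hne h0 hdir x hx := by
    have hb : ((x : Elt S) : H →L[ℂ] H) ∈ upperBounds ((↑) '' D : Set (H →L[ℂ] H)) := by
      rintro _ ⟨d, hd, rfl⟩
      exact hx.1 hd
    have hdir' : DirectedOn (· ≤ ·) ((↑) '' D : Set (H →L[ℂ] H)) := by
      rintro _ ⟨d, hd, rfl⟩ _ ⟨e, he, rfl⟩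
      obtain ⟨f, hf, h1, h2⟩ := hdir d hd e he
      exact ⟨f, ⟨f, hf, rfl⟩, h1, h2⟩
    obtain ⟨y, hy, hyc⟩ := exists_isLUB_of_directedOn (hne.image _)
      (by rintro _ ⟨d, hd, rfl⟩; exact h0 d hd) hdir' hb
    have hyS : y ∈ S.toStarSubalgebra := by
      change y ∈ S.carrier
      rw [← S.centralizer_centralizer', Set.mem_centralizer_iff]
      intro c hc
      refine hyc c ?_
      rintro _ ⟨d, hd, rfl⟩
      exact ((Set.mem_centralizer_iff.1 hc) _ d.2).symm
    have hy' : IsLUB D (⟨y, hyS⟩ : Elt S) :=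
      ⟨fun d hd => hy.1 ⟨d, hd, rfl⟩, fun z hz => hy.2 (by
        rintro _ ⟨d, hd, rfl⟩
        exact hz hd)⟩
    obtain rfl := hx.unique hy'
    obtain ⟨d₀, hd₀⟩ := hne
    have hx0 : (0 : Elt S) ≤ ⟨y, hyS⟩ := (h0 d₀ hd₀).trans (hx.1 hd₀)
    have h := hfull.normal (incl S '' D) (Set.Nonempty.image _ ⟨d₀, hd₀⟩)
      (by rintro _ ⟨d, hd, rfl⟩; exact h0 d hd)
      (by
        rintro _ ⟨d, hd, rfl⟩ _ ⟨e, he, rfl⟩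
        obtain ⟨f, hf, h1, h2⟩ := hdir d hd e he
        exact ⟨incl S f, ⟨f, hf, rfl⟩, h1, h2⟩)
      (incl S ⟨y, hyS⟩)
      ⟨by rintro _ ⟨d, hd, rfl⟩; exact hx.1 hd, fun z hz => hy.2 (by
        rintro _ ⟨d, hd, rfl⟩
        exact hz ⟨d, hd, rfl⟩)⟩
    rw [hτ _ hx0]
    refine h.trans ?_
    rw [iSup_image]
    exact iSup_congr fun d => iSup_congr fun hd => (hτ d (h0 d hd)).symm
  semifinite x hx hx0 := by
    obtain ⟨y, hy0, hyx, hy, hfin⟩ := hsemi x hx hx0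
    exact ⟨y, hy0, hyx, hy, by rwa [hτ y hy0]⟩
  faithful x hx h0 := by
    rw [hτ x hx] at h0
    have h := hfull.faithful (incl S x) hx h0
    exact Subtype.ext (congrArg (fun z : Elt (fullAlgebra H) => (z : H →L[ℂ] H)) h)

end Directed

section GroupTrace

variable {G : Type*} [Group G] [TopologicalSpace G] [IsTopologicalGroup G] [CompactSpace G]
  [T2Space G] [MeasurableSpace G] [BorelSpace G]
  (μ : Measure G) [μ.IsHaarMeasure] [IsProbabilityMeasure μ]

/-- Semifiniteness of the trace of `VN(G)`. -/
theorem exists_le_posTrace_lt_top (x : Elt (groupVN μ)) (hx : 0 ≤ x) (hx0 : x ≠ 0) :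
    ∃ y : Elt (groupVN μ), 0 ≤ y ∧ y ≤ x ∧ y ≠ 0 ∧
      posTrace (y : Lp ℂ 2 μ →L[ℂ] Lp ℂ 2 μ) < ∞ := by
  obtain ⟨⟨v, hvm⟩, hvs, hvv⟩ := exists_sqrt hx
  dsimp only at hvs hvv
  have hv0 : v ≠ 0 := fun h => hx0 (Subtype.ext (by rw [← hvv, h, mul_zero]; rfl))
  obtain ⟨h, hh⟩ : ∃ h : C(G, ℂ), v * leftConv μ (toL2 μ h) ≠ 0 := by
    by_contra! hcon
    exact hv0 (eq_zero_of_mul_leftConv_eq_zero μ hcon)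
  -- normalize so that `b = λ(k)` is a contraction; then `v b b* v ≤ v²`
  obtain ⟨k, hk, hk1⟩ : ∃ k, v * leftConv μ k ≠ 0 ∧ ‖leftConv μ k‖ ≤ 1 := by
    set r := ‖leftConv μ (toL2 μ h)‖ with hr
    have hr0 : r ≠ 0 := fun h0 => hh (by rw [norm_eq_zero.1 h0, mul_zero])
    refine ⟨((r⁻¹ : ℝ) : ℂ) • toL2 μ h, ?_, ?_⟩
    · rw [map_smul, mul_smul_comm]
      exact smul_ne_zero (by exact_mod_cast inv_ne_zero hr0) hh
    · rw [map_smul, norm_smul, ← hr, Complex.norm_real, norm_inv, hr, norm_norm, ← hr,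
        inv_mul_cancel₀ hr0]
  set b := leftConv μ k with hb
  have hmem : (v * b) * star (v * b) ∈ (groupVN μ).toStarSubalgebra :=
    have h1 := mul_mem hvm (leftConv_mem_groupVN μ k)
    mul_mem h1 (star_mem h1)
  refine ⟨⟨_, hmem⟩, mul_star_self_nonneg (v * b), ?_, fun h0 => hk ?_, ?_⟩
  · change v * b * star (v * b) ≤ (x : Lp ℂ 2 μ →L[ℂ] Lp ℂ 2 μ)
    rw [← hvv]
    exact mul_mul_star_le_of_norm_le_one hvs hk1
  · exact (CStarRing.mul_star_self_eq_zero_iff _).1 (congrArg Subtype.val h0)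
  · rw [← posTrace_star_mul_self_comm]
    exact isHilbertSchmidt_iff.1 ((isHilbertSchmidt_leftConv μ k).mul_left v)

theorem isNSFTrace_plancherelTrace
    (hfull : IsNSFTrace (fullAlgebra (Lp ℂ 2 μ)) operatorTrace) :
    IsNSFTrace (groupVN μ) (plancherelTrace μ) :=
  isNSFTrace_of_eq_posTrace (plancherelTrace_eq_posTrace μ) hfull (exists_le_posTrace_lt_top μ)

end GroupTrace

variable {G : Type*} [Group G] [TopologicalSpace G] [IsTopologicalGroup G] [CompactSpace G]
  [T2Space G] [MeasurableSpace G] [BorelSpace G]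
  (μ : Measure G) [μ.IsHaarMeasure] [IsProbabilityMeasure μ]

local notation "L²" => Lp ℂ 2 μ

/-! ### The conditional expectation onto the group von Neumann algebra -/

section Average

theorem continuous_rightReg_conj (z : L² →L[ℂ] L²) (ξ : L²) :
    Continuous fun t => (rightReg μ t * z * rightReg μ t⁻¹) ξ := by
  have hc : Continuous fun s : G => (⟨fun t => t * s, by fun_prop⟩ : C(G, G)) :=
    ContinuousMap.continuous_of_continuous_uncurry _ (by
      simp only [Function.uncurry_def, ContinuousMap.coe_mk]; fun_prop)
  exact Continuous.compMeasurePreservingLp (z.continuous.comp (continuous_rightReg_inv μ ξ)) hc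
    (fun s => measurePreserving_mul_right μ s) (by norm_num)

/-- The average `∫ ρ(t) z ρ(t)⁻¹ dt` of an operator over the right regular representation, a strong
integral; the function `1` is the weight in `opIntegral`. -/
noncomputable def average (z : L² →L[ℂ] L²) : L² →L[ℂ] L² :=
  opIntegral μ (fun t => rightReg μ t * z * rightReg μ t⁻¹) (continuous_rightReg_conj μ z)
    (toL2 μ 1)

theorem average_apply (z : L² →L[ℂ] L²) (ξ : L²) :
    average μ z ξ = ∫ t, rightReg μ t (z (rightReg μ t⁻¹ ξ)) ∂μ := by
  refine integral_congr_ae ?_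
  filter_upwards [coeFn_toL2 μ 1] with t ht
  rw [ht]
  simp

theorem average_commute (z : L² →L[ℂ] L²) (r : G) :
    average μ z * rightReg μ r = rightReg μ r * average μ z := by
  ext1 ξ
  have h1 : ∀ s t ζ, rightReg μ s (rightReg μ t ζ) = rightReg μ (s * t) ζ := fun s t ζ =>
    DFunLike.congr_fun (rightReg_mul μ s t) ζ
  have h2 : rightReg μ r (average μ z ξ) =
      ∫ t, rightReg μ r (rightReg μ t (z (rightReg μ t⁻¹ ξ))) ∂μ := by
    rw [average_apply, ← (rightReg μ r).integral_comp_comm]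
    have := integrable_smul_of_continuous (toL2 μ 1) (continuous_rightReg_conj μ z ξ)
    refine this.congr ?_
    filter_upwards [coeFn_toL2 μ 1] with t ht
    rw [ht]
    simp
  rw [mul_apply_eq_comp, mul_apply_eq_comp, h2, average_apply]
  simp only [h1]
  rw [← integral_mul_left_eq_self _ r]
  simp [mul_assoc]

theorem average_mem_groupVN (z : L² →L[ℂ] L²) :
    average μ z ∈ (groupVN μ).toStarSubalgebra :=
  (mem_groupVN_iff_commute_rightReg μ).2 (average_commute μ z)

theorem average_eq_self {x : L² →L[ℂ] L²} (hx : x ∈ (groupVN μ).toStarSubalgebra) :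
    average μ x = x := by
  rw [mem_groupVN_iff_commute_rightReg] at hx
  ext1 ξ
  have h1 : ∀ t, rightReg μ t (x (rightReg μ t⁻¹ ξ)) = x ξ := fun t => by
    have h2 := DFunLike.congr_fun (hx t⁻¹) ξ
    have h3 := DFunLike.congr_fun (rightReg_mul μ t t⁻¹) (x ξ)
    rw [mul_apply_eq_comp, mul_apply_eq_comp] at h2
    rw [mul_apply_eq_comp, mul_inv_cancel, rightReg_one] at h3
    rw [h2, h3]
    rfl
  rw [average_apply]
  simp [h1]

/-- Averaging preserves the trace against `VN(G)`: the sum over the orthonormal basis may be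
interchanged with the average, and `tr(v ρ(t) z ρ(t)⁻¹ v) = tr(z v²)` since `ρ(t)` commutes
with `v`. -/
theorem opTrace_mul_average_mul (z : L² →L[ℂ] L²) {v : L² →L[ℂ] L²} (hv : star v = v)
    (hHS : IsHilbertSchmidt v) (hvm : v ∈ (groupVN μ).toStarSubalgebra) :
    opTrace (v * (average μ z * v)) = opTrace (z * v * v) := by
  rw [mem_groupVN_iff_commute_rightReg] at hvm
  set g : BasisIndex L² → G → ℂ := fun i t =>
    ⟪v (traceBasis L² i), (rightReg μ t * z * rightReg μ t⁻¹) (v (traceBasis L² i))⟫_ℂ with hg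
  have hsum : ∀ t, HasSum (fun i => g i t) (opTrace (z * v * v)) := fun t => by
    have e1 : star v * ((rightReg μ t * z * rightReg μ t⁻¹) * v) =
        (rightReg μ t * v) * (z * v * rightReg μ t⁻¹) := by
      simp only [mul_assoc, hv]
      rw [← hvm t⁻¹, ← mul_assoc, hvm, mul_assoc]
    have e2 : (z * v * rightReg μ t⁻¹) * (rightReg μ t * v) = z * v * v := by
      rw [mul_assoc (z * v), ← mul_assoc (rightReg μ t⁻¹), rightReg_mul, inv_mul_cancel,
        rightReg_one, one_mul]
    have ha := hHS.mul_left (rightReg μ t)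
    have hb := (hHS.mul_left z).mul_right (rightReg μ t⁻¹)
    have h := ha.hasSum_mul hb
    rw [ha.opTrace_mul_comm hb, e2] at h
    refine (h.congr e1.symm).congr_fun fun i => ?_
    rw [inner_star_mul_apply, mul_apply_eq_comp]
  have hint := hasSum_integral_mul_of_summable (g := g)
    (b := fun i => ‖z‖ * ‖v (traceBasis L² i)‖ ^ 2)
    (fun i => continuous_const.inner (continuous_rightReg_conj μ z _))
    (Summable.mul_left _ hHS) (fun i t => by
      refine (norm_inner_le_norm _ _).trans ?_
      rw [mul_apply_eq_comp, mul_apply_eq_comp, norm_rightReg_apply]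
      have h1 := z.le_opNorm (rightReg μ t⁻¹ (v (traceBasis L² i)))
      rw [norm_rightReg_apply] at h1
      nlinarith [norm_nonneg (v (traceBasis L² i))]) (toL2 μ 1)
  have h1 : ∫ s, toL2 μ 1 s * ∑' i, g i s ∂μ = opTrace (z * v * v) := by
    rw [integral_toL2_mul]
    simp [(hsum _).tsum_eq]
  rw [h1] at hint
  rw [← hint.tsum_eq]
  refine tsum_congr fun i => ?_
  have h2 := inner_star_mul_apply v (average μ z * v) (traceBasis L² i) (traceBasis L² i)
  rw [hv] at h2
  rw [h2, mul_apply_eq_comp, average, inner_opIntegral]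

/-- The conditional expectation `B(L²(G)) → VN(G)`, given by averaging over the right regular
representation. -/
noncomputable def averageVN (z : Elt (fullAlgebra L²)) : Elt (groupVN μ) :=
  ⟨average μ z, average_mem_groupVN μ z⟩

theorem averageVN_incl (x : Elt (groupVN μ)) : averageVN μ (incl (groupVN μ) x) = x :=
  Subtype.ext (average_eq_self μ x.2)

theorem hasTrace_averageVN_mul (z : Elt (fullAlgebra L²)) {x : Elt (groupVN μ)} (hx : 0 ≤ x)
    (hfin : plancherelTrace μ x < ∞) {c : ℂ}
    (hc : HasTrace operatorTrace (z * incl (groupVN μ) x) c) :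
    HasTrace (plancherelTrace μ) (averageVN μ z * x) c := by
  rw [plancherelTrace_eq_posTrace μ x hx] at hfin
  obtain ⟨v, hv, hvx⟩ := exists_sqrt hx
  have hHS := isHilbertSchmidt_of_mul_self hv hvx hfin
  have hz : (z : L² →L[ℂ] L²) * v * v = ((z * incl (groupVN μ) x : Elt (fullAlgebra L²)) :
      L² →L[ℂ] L²) := by
    rw [mul_assoc, hvx]
    rfl
  have h1 := exists_hasTrace_mul (plancherelTrace_eq_posTrace μ) (a := averageVN μ z * v) (b := v)
    (hHS.mul_left _) hHS
  have h2 : averageVN μ z * v * v = averageVN μ z * x := by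
    rw [mul_assoc]
    exact congrArg _ (Subtype.ext hvx)
  have h3 : opTrace (((averageVN μ z * v : Elt (groupVN μ)) : L² →L[ℂ] L²) * (v : L² →L[ℂ] L²)) =
      c := by
    refine ((hHS.mul_left (average μ z)).opTrace_mul_comm hHS).trans ?_
    rw [opTrace_mul_average_mul μ z hv hHS v.2]
    have h4 := (hHS.mul_left (z : L² →L[ℂ] L²)).hasSum_mul hHS
    have h5 := hc.hasOpTrace fun _ _ => rfl
    rw [← hz] at h5
    exact h4.unique h5
  rwa [h2, h3] at h1

end Average

/-! ### Schur multipliers and Fourier multipliers -/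

section Multipliers

variable {u : G → ℂ}

theorem hasKernel_leftConv (h : C(G, ℂ)) :
    HasKernel μ (fun p => h (p.1 * p.2⁻¹)) (leftConv μ (toL2 μ h)) := fun g => by
  obtain ⟨k, hk1, hk2⟩ := exists_continuousMap_leftConv μ h g
  rw [hk1]
  filter_upwards [coeFn_toL2 μ k] with s hs
  rw [hs, hk2]
  simp only [mul_comm]

theorem HasKernel.unique {F : G × G → ℂ} {x y : L² →L[ℂ] L²} (hx : HasKernel μ F x)
    (hy : HasKernel μ F y) : x = y := by
  ext1 g
  refine Lp.ext ?_
  filter_upwards [hx g, hy g] with s h1 h2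
  rw [h1, h2]

/-- Although the product `σ`-algebra may be smaller than the Borel `σ`-algebra of `G × G`,
continuous functions on `G × G` are measurable for it. -/
theorem memLp_of_continuous_prod {F : G × G → ℂ} (hF : Continuous F) :
    MemLp F 2 (μ.prod μ) := by
  obtain ⟨C, hC⟩ := (isCompact_range hF).isBounded.exists_norm_le
  exact MemLp.of_bound (HasCompactSupport.stronglyMeasurable_of_prod hF
    (HasCompactSupport.of_compactSpace F)).aestronglyMeasurable C
    (ae_of_all _ fun p => hC _ ⟨p, rfl⟩)

/-- `T(λ(h)) = λ(uh)`, by comparison of kernels. -/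
theorem IsSchurMultiplier.apply_leftConv {T : Elt (fullAlgebra L²) →ₗ[ℂ] Elt (fullAlgebra L²)}
    (hu : Continuous u)
    (hT : IsSchurMultiplier μ (fun s t => u (s * t⁻¹)) T) (h : C(G, ℂ)) :
    (T ⟨leftConv μ (toL2 μ h), mem_fullAlgebra _⟩ : L² →L[ℂ] L²) =
      leftConv μ (toL2 μ (⟨u, hu⟩ * h)) := by
  have hF : MemLp (fun p : G × G => h (p.1 * p.2⁻¹)) 2 (μ.prod μ) :=
    memLp_of_continuous_prod μ (by fun_prop)
  have h1 : HasKernel μ (fun p : G × G => u (p.1 * p.2⁻¹) * h (p.1 * p.2⁻¹))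
      (T ⟨leftConv μ (toL2 μ h), mem_fullAlgebra _⟩ : L² →L[ℂ] L²) :=
    hT.2 _ hF _ (hasKernel_leftConv μ h)
  have h2 := hasKernel_leftConv μ (⟨u, hu⟩ * h)
  simp only [ContinuousMap.mul_apply, ContinuousMap.coe_mk] at h2
  exact HasKernel.unique μ h1 h2

/-- The Schur multiplier with symbol `u(st⁻¹)` maps `λ(s)` to `u(s)λ(s)`: by normality, this
follows from its action on the operators `λ(h)` with `h` continuous. -/
theorem IsSchurMultiplier.apply_leftReg {T : Elt (fullAlgebra L²) →ₗ[ℂ] Elt (fullAlgebra L²)}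
    (hu : Continuous u)
    (hT : IsSchurMultiplier μ (fun s t => u (s * t⁻¹)) T) (s : G) :
    (T ⟨leftReg μ s, mem_fullAlgebra _⟩ : L² →L[ℂ] L²) = u s • leftReg μ s := by
  ext1 ξ
  refine ext_inner_left ℂ fun η => ?_
  obtain ⟨h1, h2⟩ := continuous_and_map_opIntegral (μ := μ) (ψ := vectorFunctional T ξ η)
    (continuous_vectorFunctional hT.1 ξ η) (continuous_leftReg μ) (fun _ => mem_fullAlgebra _)
    (fun _ => mem_fullAlgebra _)
  have h3 : Continuous fun s => u s * ⟪η, leftReg μ s ξ⟫_ℂ :=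
    hu.mul (continuous_const.inner (continuous_leftReg μ ξ))
  refine (eq_of_integral_mul_eq μ h1 h3 (fun h => ?_) s).trans (inner_smul_right _ _ _).symm
  have h4 : ⟪η, (T ⟨leftConv μ (toL2 μ h), mem_fullAlgebra _⟩ : L² →L[ℂ] L²) ξ⟫_ℂ = _ :=
    h2 (toL2 μ h)
  rw [hT.apply_leftConv μ hu, leftConv, inner_opIntegral, integral_toL2_mul] at h4
  refine h4.symm.trans ?_
  rw [integral_toL2_mul]
  refine integral_congr_ae (ae_of_all _ fun t => ?_)
  simp only [ContinuousMap.mul_apply, ContinuousMap.coe_mk]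
  ring

/-- Normal maps agreeing on the operators `λ(s)` agree on `VN(G)`. -/
theorem eq_of_leftRegVN_eq {R R' : VonNeumannAlgebra L²} {f : Elt (groupVN μ) →ₗ[ℂ] Elt R}
    {f' : Elt (groupVN μ) →ₗ[ℂ] Elt R'} (hf : IsNormalMap f) (hf' : IsNormalMap f')
    (h : ∀ s, (f (leftRegVN μ s) : L² →L[ℂ] L²) = f' (leftRegVN μ s)) (x : Elt (groupVN μ)) :
    (f x : L² →L[ℂ] L²) = f' x := by
  ext1 ξ
  refine ext_inner_left ℂ fun η => sub_eq_zero.1 ?_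
  refine eq_zero_of_leftRegVN_eq_zero μ
    (ψ := vectorFunctional f ξ η - vectorFunctional f' ξ η) ?_ (fun s => ?_) x
  · exact continuous_vectorFunctional_sub hf hf' ξ η ξ η
  · rw [LinearMap.sub_apply, sub_eq_zero]
    exact congrArg (fun a : L² →L[ℂ] L² => ⟪η, a ξ⟫_ℂ) (h s)

/-- The Schur multiplier leaves `VN(G)` invariant: that `T(x)` commutes with `ρ(r)` is an
ultraweakly continuous linear condition on `x`, which holds for `x = λ(s)`. -/
theorem IsSchurMultiplier.apply_mem_groupVN {T : Elt (fullAlgebra L²) →ₗ[ℂ] Elt (fullAlgebra L²)}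
    (hu : Continuous u)
    (hT : IsSchurMultiplier μ (fun s t => u (s * t⁻¹)) T) (x : Elt (groupVN μ)) :
    (T (incl (groupVN μ) x) : L² →L[ℂ] L²) ∈ (groupVN μ).toStarSubalgebra := by
  rw [mem_groupVN_iff_commute_rightReg]
  intro r
  ext1 ξ
  refine ext_inner_left ℂ fun η => sub_eq_zero.1 ?_
  let f := T ∘ₗ inclLinear (groupVN μ)
  have hf : IsNormalMap f := IsNormalMap.comp_inclLinear hT.1 (groupVN μ)
  have hψ : ∀ y, (vectorFunctional f (rightReg μ r ξ) η -
      vectorFunctional f ξ (rightReg μ r⁻¹ η)) y =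
      ⟪η, ((f y : L² →L[ℂ] L²) * rightReg μ r) ξ⟫_ℂ -
        ⟪η, (rightReg μ r * (f y : L² →L[ℂ] L²)) ξ⟫_ℂ := fun y => by
    rw [mul_apply_eq_comp, mul_apply_eq_comp, ← star_rightReg, LinearMap.sub_apply,
      vectorFunctional_apply, vectorFunctional_apply, ContinuousLinearMap.star_eq_adjoint,
      ContinuousLinearMap.adjoint_inner_left]
  refine (hψ x).symm.trans (eq_zero_of_leftRegVN_eq_zero μ ?_ (fun s => ?_) x)
  · exact continuous_vectorFunctional_sub hf hf _ _ _ _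
  · have h1 : (f (leftRegVN μ s) : L² →L[ℂ] L²) = u s • leftReg μ s := hT.apply_leftReg μ hu s
    rw [hψ, h1, smul_mul_assoc, mul_smul_comm, leftReg_mul_rightReg, sub_self]

/-- The restriction of the Schur multiplier with symbol `u(st⁻¹)` to `VN(G)` is the Fourier
multiplier with symbol `u`. -/
theorem IsSchurMultiplier.exists_isFourierMultiplier
    {T : Elt (fullAlgebra L²) →ₗ[ℂ] Elt (fullAlgebra L²)}
    (hu : Continuous u)
    (hT : IsSchurMultiplier μ (fun s t => u (s * t⁻¹)) T) :
    ∃ M, IsFourierMultiplier μ u M := by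
  obtain ⟨M, hM, h⟩ := IsNormalMap.exists_restrict hT.1 (hT.apply_mem_groupVN μ hu)
  exact ⟨M, hM, fun t => Subtype.ext ((h _).trans (hT.apply_leftReg μ hu t))⟩

theorem IsFourierMultiplier.incl_apply {T : Elt (fullAlgebra L²) →ₗ[ℂ] Elt (fullAlgebra L²)}
    (hu : Continuous u)
    (hT : IsSchurMultiplier μ (fun s t => u (s * t⁻¹)) T)
    {M : Elt (groupVN μ) →ₗ[ℂ] Elt (groupVN μ)} (hM : IsFourierMultiplier μ u M)
    (x : Elt (groupVN μ)) : T (incl (groupVN μ) x) = incl (groupVN μ) (M x) := by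
  refine Subtype.ext ?_
  refine eq_of_leftRegVN_eq μ
    (f := T ∘ₗ inclLinear (groupVN μ))
    (f' := M) (IsNormalMap.comp_inclLinear hT.1 (groupVN μ)) hM.1 (fun s => ?_) x
  rw [hM.2]
  exact hT.apply_leftReg μ hu s

end Multipliers

/-! ### Restricting dilations -/

/-- An absolute dilation `(N, J, U)` of the Schur multiplier restricts to one of the Fourier
multiplier: compose `J` with the inclusion `VN(G) ⊆ B(L²(G))`, which preserves the trace, and
the conditional expectation with the averaging map. -/
theorem IsFourierMultiplier.isAbsolutelyDilatable.{v', u'} {G : Type u'} [Group G]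
    [TopologicalSpace G] [IsTopologicalGroup G] [CompactSpace G] [T2Space G] [MeasurableSpace G]
    [BorelSpace G] (μ : Measure G) [μ.IsHaarMeasure] [IsProbabilityMeasure μ] {u : G → ℂ}
    {T : Elt (fullAlgebra (Lp ℂ 2 μ)) →ₗ[ℂ] Elt (fullAlgebra (Lp ℂ 2 μ))} (hu : Continuous u)
    (hT : IsSchurMultiplier μ (fun s t => u (s * t⁻¹)) T)
    (hdil : IsAbsolutelyDilatable.{u', v'} (fullAlgebra (Lp ℂ 2 μ)) operatorTrace T)
    {M : Elt (groupVN μ) →ₗ[ℂ] Elt (groupVN μ)} (hM : IsFourierMultiplier μ u M) :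
    IsAbsolutelyDilatable.{u', v'} (groupVN μ) (plancherelTrace μ) M := by
  obtain ⟨hfull, K, i1, i2, i3, N, σ, J, U, E, hσ, hJ, hJt, hU, hE, hdil⟩ := hdil
  refine ⟨isNSFTrace_plancherelTrace μ hfull, K, i1, i2, i3, N, σ, J.comp (incl (groupVN μ)), U,
    fun y => averageVN μ (E y), hσ, ?_, fun x hx => ?_, hU, fun y x hx hfin => ?_, fun k x => ?_⟩
  · exact IsNormalMap.comp_incl hJ (groupVN μ)
  · exact (hJt (incl (groupVN μ) x) hx).trans (plancherelTrace_eq_posTrace μ x hx).symm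
  · have hfin' : operatorTrace (incl (groupVN μ) x) < ⊤ :=
      (plancherelTrace_eq_posTrace μ x hx).symm.trans_lt hfin
    obtain ⟨c, hc1, hc2⟩ := hE y (incl (groupVN μ) x) hx hfin'
    exact ⟨c, hasTrace_averageVN_mul μ (E y) hx hfin hc1, hc2⟩
  · change _ = averageVN μ (E (U^[k] (J (incl (groupVN μ) x))))
    rw [← hdil, incl_pow_apply (hM.incl_apply μ hu hT), averageVN_incl]

end AbsDilation

theorem proposition4p3 {G : Type u} [Group G] [TopologicalSpace G] [IsTopologicalGroup G]
    [CompactSpace G] [T2Space G] [MeasurableSpace G] [BorelSpace G]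
    (μ : MeasureTheory.Measure G) [μ.IsHaarMeasure] [μ.Regular]
    [MeasureTheory.IsProbabilityMeasure μ]
    (u : G → ℂ) (hu : Continuous u) (hu1 : u 1 = 1) (hpos : AbsDilation.IsPosDefFun u)
    (T : AbsDilation.Elt (AbsDilation.fullAlgebra (MeasureTheory.Lp ℂ 2 μ)) →ₗ[ℂ]
      AbsDilation.Elt (AbsDilation.fullAlgebra (MeasureTheory.Lp ℂ 2 μ)))
    (hT : AbsDilation.IsSchurMultiplier μ (fun s t => u (s * t⁻¹)) T)
    (hdil : AbsDilation.IsAbsolutelyDilatable.{u, v}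
      (AbsDilation.fullAlgebra (MeasureTheory.Lp ℂ 2 μ)) AbsDilation.operatorTrace T) :
    (∃ M, AbsDilation.IsFourierMultiplier μ u M) ∧
    ∀ M, AbsDilation.IsFourierMultiplier μ u M →
      AbsDilation.IsAbsolutelyDilatable.{u, v}
        (AbsDilation.groupVN μ) (AbsDilation.plancherelTrace μ) M := by
  exact ⟨hT.exists_isFourierMultiplier μ hu,
    fun M hM => hM.isAbsolutelyDilatable μ hu hT hdil⟩
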